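/- Let $q$ be a complex number with $0<|q|<1$. For $x\in\mathbb{C}$, $|p|<1$ and $n\ge 0$ write $(x;p)_n=\prod_{i=0}^{n-1}(1-p^i x)$ and $(x;p)_\infty=\prod_{i\ge 0}(1-p^i x)$, and for $x\neq 0$, $p\ne 0$ let $j(x;p)=(x;p)_\infty(p/x;p)_\infty(p;p)_\infty$. For integers $a,m$ with $m>0$ put $J_{a,m}=j(q^a;q^m)$, $\overline{J}_{a,m}=j(-q^a;q^m)$ and $J_m=\prod_{i\ge 1}(1-q^{mi})$. Let $$g(x,p)=x^{-1}\Big(-1+\sum_{n=0}^{\infty}\frac{p^{n^2}}{(x;p)_{n+1}(p/x;p)_n}\Big)$$ be the universal mock theta function, and let $$\overline{\psi}_0(q)=\sum_{n=0}^{\infty}\frac{q^{2n^2}}{(-q;q)_{2n}},\qquad \overline{\psi}_1(q)=\sum_{n=0}^{\infty}\frac{q^{2n^2+2n}}{(-q;q)_{2n+1}}$$ be Andrews' new mock theta functions. Then $$\overline{\psi}_0(q)=2-2q\,g(-q,q^8)-\frac{J_{1,2}\,\overline{J}_{3,8}}{J_2},$$ $$\overline{\psi}_1(q)=2q^2\,g(-q^3,q^8)+\frac{J_{1,2}\,\overline{J}_{1,8}}{J_2}.$$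 -/

import Mathlib

noncomputable section

namespace MockTheta

/-- The finite `q`-Pochhammer symbol `(x; q)_n = ∏_{i=0}^{n-1} (1 - q^i x)`. -/
def qPoch (x q : ℂ) (n : ℕ) : ℂ :=
  ∏ i ∈ Finset.range n, (1 - q ^ i * x)

/-- The infinite `q`-Pochhammer symbol `(x; q)_∞ = ∏_{i ≥ 0} (1 - q^i x)`. -/
def qPochInf (x q : ℂ) : ℂ :=
  ∏' i : ℕ, (1 - q ^ i * x)

/-- The theta function `j(x; q) = (x; q)_∞ (q/x; q)_∞ (q; q)_∞`. -/
def theta (x q : ℂ) : ℂ :=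
  qPochInf x q * qPochInf (q / x) q * qPochInf q q

/-- `J_{a,m} = j(q^a; q^m)`. -/
def J (a : ℤ) (m : ℕ) (q : ℂ) : ℂ :=
  theta (q ^ a) (q ^ m)

/-- `J̄_{a,m} = j(-q^a; q^m)`. -/
def Jbar (a : ℤ) (m : ℕ) (q : ℂ) : ℂ :=
  theta (-q ^ a) (q ^ m)

/-- `J_m = ∏_{i ≥ 1} (1 - q^{m i})`. -/
def Jm (m : ℕ) (q : ℂ) : ℂ :=
  ∏' i : ℕ, (1 - q ^ (m * (i + 1)))

/-- The universal mock theta function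
`g(x, q) = x⁻¹ (-1 + ∑_{n ≥ 0} q^{n²} / ((x; q)_{n+1} (q/x; q)_n))`. -/
def g (x q : ℂ) : ℂ :=
  x⁻¹ * (-1 + ∑' n : ℕ, q ^ (n ^ 2) / (qPoch x q (n + 1) * qPoch (q / x) q n))

/-- `ψ̄₀(q) = ∑_{n ≥ 0} q^{2n²} / (-q; q)_{2n}`. -/
def psiBar₀ (q : ℂ) : ℂ :=
  ∑' n : ℕ, q ^ (2 * n ^ 2) / qPoch (-q) q (2 * n)

/-- `ψ̄₁(q) = ∑_{n ≥ 0} q^{2n²+2n} / (-q; q)_{2n+1}`. -/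
def psiBar₁ (q : ℂ) : ℂ :=
  ∑' n : ℕ, q ^ (2 * n ^ 2 + 2 * n) / qPoch (-q) q (2 * n + 1)

/-! The products and series above converge for `|q| < 1`, so none of the values is a default
value of `∏'` or `∑'`, and the denominator `J_m` does not vanish. -/

theorem multipliable_qPochInf (x : ℂ) {q : ℂ} (hq : ‖q‖ < 1) :
    Multipliable fun i : ℕ => 1 - q ^ i * x := by
  have : Summable fun i : ℕ => ‖-(q ^ i * x)‖ := by
    simpa [norm_mul] using (summable_geometric_of_lt_one (norm_nonneg q) hq).mul_right ‖x‖
  simpa [sub_eq_add_neg] using multipliable_one_add_of_summable this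

theorem summable_of_ratio {f r : ℕ → ℂ} (hf : ∀ n, f (n + 1) = r n * f n)
    (hr : Filter.Tendsto r Filter.atTop (nhds 0)) : Summable f := by
  refine summable_of_ratio_norm_eventually_le (r := 1 / 2) (by norm_num) ?_
  have h := hr.norm
  rw [norm_zero] at h
  filter_upwards [h.eventually_le_const (by norm_num : (0 : ℝ) < 1 / 2)] with n hn
  rw [hf, norm_mul]
  gcongr

theorem tendsto_pow_lin {q : ℂ} (hq : ‖q‖ < 1) (a b : ℕ) (ha : 0 < a) :
    Filter.Tendsto (fun n : ℕ => q ^ (a * n + b)) Filter.atTop (nhds 0) := by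
  refine (tendsto_pow_atTop_nhds_zero_of_norm_lt_one hq).comp ?_
  refine Filter.tendsto_atTop_mono (fun n => ?_) Filter.tendsto_id
  simp only [id]
  nlinarith

theorem summable_g (x : ℂ) {q : ℂ} (hq : ‖q‖ < 1) :
    Summable fun n : ℕ => q ^ (n ^ 2) / (qPoch x q (n + 1) * qPoch (q / x) q n) := by
  refine summable_of_ratio
    (r := fun n => q ^ (2 * n + 1) / ((1 - q ^ (1 * n + 1) * x) * (1 - q ^ (1 * n + 0) * (q / x))))
    (fun n => ?_) ?_
  · simp only [qPoch, Finset.prod_range_succ _ (n + 1), Finset.prod_range_succ _ n]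
    rw [show (n + 1) ^ 2 = n ^ 2 + (2 * n + 1) by ring, pow_add, div_mul_div_comm, one_mul]
    congr 1 <;> ring
  · have h1 := (((tendsto_pow_lin hq 1 1 one_pos).mul_const x).const_sub 1).mul
      (((tendsto_pow_lin hq 1 0 one_pos).mul_const (q / x)).const_sub 1)
    have h := (tendsto_pow_lin hq 2 1 two_pos).div h1 (by simp)
    simpa [Pi.div_def] using h

theorem summable_psiBar₀ {q : ℂ} (hq : ‖q‖ < 1) :
    Summable fun n : ℕ => q ^ (2 * n ^ 2) / qPoch (-q) q (2 * n) := by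
  refine summable_of_ratio
    (r := fun n => q ^ (4 * n + 2) / ((1 - q ^ (2 * n + 0) * -q) * (1 - q ^ (2 * n + 1) * -q)))
    (fun n => ?_) ?_
  · simp only [qPoch, show 2 * (n + 1) = 2 * n + 1 + 1 by ring, Finset.prod_range_succ]
    rw [show 2 * (n + 1) ^ 2 = 2 * n ^ 2 + (4 * n + 2) by ring, pow_add, div_mul_div_comm]
    congr 1 <;> ring
  · have h1 := (((tendsto_pow_lin hq 2 0 two_pos).mul_const (-q)).const_sub 1).mul
      (((tendsto_pow_lin hq 2 1 two_pos).mul_const (-q)).const_sub 1)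
    have h := (tendsto_pow_lin hq 4 2 four_pos).div h1 (by simp)
    simpa [Pi.div_def] using h

theorem summable_psiBar₁ {q : ℂ} (hq : ‖q‖ < 1) :
    Summable fun n : ℕ => q ^ (2 * n ^ 2 + 2 * n) / qPoch (-q) q (2 * n + 1) := by
  refine summable_of_ratio
    (r := fun n => q ^ (4 * n + 4) / ((1 - q ^ (2 * n + 1) * -q) * (1 - q ^ (2 * n + 2) * -q)))
    (fun n => ?_) ?_
  · simp only [qPoch, show 2 * (n + 1) + 1 = 2 * n + 1 + 1 + 1 by ring,
      Finset.prod_range_succ _ (2 * n + 1 + 1), Finset.prod_range_succ _ (2 * n + 1)]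
    rw [show 2 * (n + 1) ^ 2 + 2 * (n + 1) = 2 * n ^ 2 + 2 * n + (4 * n + 4) by ring,
      pow_add _ (2 * n ^ 2 + 2 * n), div_mul_div_comm]
    congr 1 <;> ring
  · have h1 := (((tendsto_pow_lin hq 2 1 two_pos).mul_const (-q)).const_sub 1).mul
      (((tendsto_pow_lin hq 2 2 two_pos).mul_const (-q)).const_sub 1)
    have h := (tendsto_pow_lin hq 4 4 four_pos).div h1 (by simp)
    simpa [Pi.div_def] using h

theorem Jm_ne_zero {m : ℕ} (hm : 0 < m) {q : ℂ} (hq : ‖q‖ < 1) : Jm m q ≠ 0 := by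
  have hqm : ‖q ^ m‖ < 1 := by
    rw [norm_pow]; exact pow_lt_one₀ (norm_nonneg q) hq hm.ne'
  have hs : Summable fun i : ℕ => ‖-(q ^ m) ^ (i + 1)‖ := by
    simpa [norm_pow, pow_succ] using
      (summable_geometric_of_lt_one (norm_nonneg (q ^ m)) hqm).mul_right ‖q ^ m‖
  have h := tprod_one_add_ne_zero_of_summable (f := fun i : ℕ => -(q ^ m) ^ (i + 1))
    (fun i h0 => ?_) hs
  · simpa [Jm, pow_mul, sub_eq_add_neg] using h
  · have h1 : (q ^ m) ^ (i + 1) = 1 := by linear_combination -h0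
    have h2 : ‖q ^ m‖ ^ (i + 1) = 1 := by rw [← norm_pow, h1, norm_one]
    exact (pow_lt_one₀ (norm_nonneg _) hqm (Nat.succ_ne_zero i)).ne h2

end MockTheta

end

/-! Put `α_r = Θ_r · A_r` with `Θ_r` a theta term and `A_r` an Appell–Lerch sum at argument
`y = -q^{-2r}`. The reflection and difference equations of Appell–Lerch sums show that the Bailey
transform of `α` is a multiple of `1 / (-q; q)_{2n}` (resp. `1 / (-q; q)_{2n+1}`), so Bailey's
lemma turns `ψ̄_k` into a Hecke-type double sum in `y = -1`. Interchanging its two summations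
leaves a single sum over `j` of an Appell–Lerch term times a theta function of nome `q^8`.

Compare with the same sum at `y = 1`: the difference carries the factor `1 - (-1)^{j+k}`, and of the
two surviving residue classes of `j` modulo `4` the theta function vanishes on one. The other gives
a level three Appell–Lerch sum, which by Bailey's lemma again (applied to finite partial fractions)
is the universal mock theta function `g`. At `y = 1` the inner Appell–Lerch sums are monomials up
to a common product, so the double sum collapses to a theta quotient. -/

noncomputable section

namespace MockTheta

open Filter Topology

theorem exists_norm_le_of_tendsto {u : ℕ → ℂ} {l : ℂ} (h : Tendsto u atTop (𝓝 l)) :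
    ∃ C, ∀ n, ‖u n‖ ≤ C := by
  obtain ⟨C, hC⟩ := (Metric.isBounded_range_of_tendsto u h).exists_norm_le
  exact ⟨C, fun n => hC _ ⟨n, rfl⟩⟩

theorem exists_norm_int_le {u : ℤ → ℂ} (hpos : ∃ C, ∀ n : ℕ, ‖u n‖ ≤ C)
    (hneg : ∃ C, ∀ n : ℕ, ‖u (-n)‖ ≤ C) : ∃ C, ∀ k, ‖u k‖ ≤ C := by
  obtain ⟨C, hC⟩ := hpos
  obtain ⟨D, hD⟩ := hneg
  refine ⟨max C D, fun k => ?_⟩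
  obtain ⟨n, rfl | rfl⟩ := k.eq_nat_or_neg
  · exact (hC n).trans (le_max_left _ _)
  · exact (hD n).trans (le_max_right _ _)

theorem exists_norm_inv_one_sub_le (x : ℂ) {p : ℂ} (hp0 : p ≠ 0) (hp1 : ‖p‖ < 1) :
    ∃ C, ∀ k : ℤ, ‖(1 - x * p ^ k)⁻¹‖ ≤ C := by
  have ht := tendsto_pow_atTop_nhds_zero_of_norm_lt_one hp1
  refine exists_norm_int_le ?_ ?_
  · refine exists_norm_le_of_tendsto (l := (1 - x * 0)⁻¹) ?_
    simpa using ((ht.const_mul x).const_sub 1).inv₀ (by simp)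
  · rcases eq_or_ne x 0 with rfl | hx
    · exact ⟨1, by simp⟩
    refine exists_norm_le_of_tendsto (l := 0 * (0 - x)⁻¹) ?_
    refine (ht.mul ((ht.sub_const x).inv₀ (by simpa using hx))).congr fun n => ?_
    have hpn : p ^ n ≠ 0 := pow_ne_zero _ hp0
    rw [zpow_neg, zpow_natCast, show 1 - x * (p ^ n)⁻¹ = (p ^ n - x) * (p ^ n)⁻¹ by field_simp,
      mul_inv, inv_inv, mul_comm]

theorem summable_mul_of_norm_le {ι : Type*} {u v : ι → ℂ} (hu : Summable u)
    (hv : ∃ C, ∀ i, ‖v i‖ ≤ C) : Summable fun i => u i * v i := by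
  obtain ⟨C, hC⟩ := hv
  refine (hu.norm.mul_right C).of_norm_bounded fun i => ?_
  rw [norm_mul]
  gcongr
  exact hC i

theorem summable_zpow_quadratic {s x : ℂ} (hs0 : s ≠ 0) (hs1 : ‖s‖ < 1) (hx : x ≠ 0) {c : ℕ}
    (hc : 0 < c) (d : ℤ) : Summable fun k : ℤ => s ^ (c * k ^ 2 + d * k) * x ^ k := by
  have half_line (d : ℤ) {x : ℂ} (hx : x ≠ 0) :
      Summable fun n : ℕ => s ^ (c * (n : ℤ) ^ 2 + d * n) * x ^ (n : ℤ) := by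
    refine summable_of_ratio (r := fun n => s ^ (2 * c * n + 0) * (s ^ (c + d) * x))
      (fun n => ?_) ?_
    · have hexp : c * ((n + 1 : ℕ) : ℤ) ^ 2 + d * (n + 1 : ℕ)
          = c * (n : ℤ) ^ 2 + d * n + (2 * c * n + 0 : ℕ) + (c + d) := by
        push_cast
        ring
      rw [hexp, zpow_add₀ hs0, zpow_add₀ hs0, zpow_natCast, Nat.cast_succ, zpow_add_one₀ hx]
      ring
    · simpa using (tendsto_pow_lin hs1 (2 * c) 0 (by positivity)).mul_const (s ^ (c + d) * x)
  refine Summable.of_nat_of_neg (half_line d hx) ((half_line (-d) (inv_ne_zero hx)).congr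
    fun n => ?_)
  rw [inv_zpow', neg_sq, neg_mul_comm]

theorem qPoch_zero (x p : ℂ) : qPoch x p 0 = 1 := by simp [qPoch]

theorem qPoch_succ (x p : ℂ) (n : ℕ) : qPoch x p (n + 1) = qPoch x p n * (1 - p ^ n * x) := by
  simp [qPoch, Finset.prod_range_succ]

theorem qPoch_one_succ (p : ℂ) (n : ℕ) : qPoch 1 p (n + 1) = 0 := by
  simp [qPoch, Finset.prod_range_succ']

theorem tendsto_qPoch (x : ℂ) {p : ℂ} (hp : ‖p‖ < 1) :
    Tendsto (qPoch x p) atTop (𝓝 (qPochInf x p)) :=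
  (multipliable_qPochInf x hp).hasProd.tendsto_prod_nat

theorem qPochInf_ne_zero {x p : ℂ} (hp : ‖p‖ < 1) (h : ∀ i : ℕ, 1 - p ^ i * x ≠ 0) :
    qPochInf x p ≠ 0 := by
  have hs : Summable fun i : ℕ => ‖-(p ^ i * x)‖ := by
    simpa [norm_mul] using (summable_geometric_of_lt_one (norm_nonneg p) hp).mul_right ‖x‖
  have := tprod_one_add_ne_zero_of_summable (f := fun i : ℕ => -(p ^ i * x))
    (fun i => by simpa [sub_eq_add_neg] using h i) hs
  simpa [qPochInf, sub_eq_add_neg] using this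

theorem one_sub_ne_zero_of_norm_lt {x : ℂ} (h : ‖x‖ < 1) : 1 - x ≠ 0 := fun h0 => by
  rw [← sub_eq_zero.1 h0] at h
  simp at h

theorem norm_pow_lt_one {s : ℂ} (hs : ‖s‖ < 1) {n : ℕ} (hn : n ≠ 0) : ‖s ^ n‖ < 1 := by
  rw [norm_pow]
  exact pow_lt_one₀ (norm_nonneg _) hs hn

theorem qPochInf_ne_zero_of_norm_lt {x p : ℂ} (hp : ‖p‖ < 1) (hx : ‖x‖ < 1) :
    qPochInf x p ≠ 0 := by
  refine qPochInf_ne_zero hp fun i => one_sub_ne_zero_of_norm_lt ?_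
  rw [norm_mul, norm_pow]
  exact (mul_le_of_le_one_left (norm_nonneg _) (pow_le_one₀ (norm_nonneg _) hp.le)).trans_lt hx

theorem qPoch_self_ne_zero {p : ℂ} (hp : ‖p‖ < 1) (n : ℕ) : qPoch p p n ≠ 0 := by
  refine Finset.prod_ne_zero_iff.2 fun i _ => one_sub_ne_zero_of_norm_lt ?_
  rw [← pow_succ]
  exact norm_pow_lt_one hp i.succ_ne_zero

/-- The reciprocal `1 / (p; p)_k`, extended to negative `k` by its usual value `0`. -/
def recipPoch (p : ℂ) (k : ℤ) : ℂ := if k < 0 then 0 else (qPoch p p k.toNat)⁻¹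

theorem recipPoch_natCast (p : ℂ) (n : ℕ) : recipPoch p n = (qPoch p p n)⁻¹ := by
  simp [recipPoch]

theorem recipPoch_of_neg (p : ℂ) {k : ℤ} (hk : k < 0) : recipPoch p k = 0 := by
  simp [recipPoch, hk]

theorem recipPoch_zero (p : ℂ) : recipPoch p 0 = 1 := by simp [recipPoch, qPoch_zero]

theorem recipPoch_eq_mul_succ {p : ℂ} (hp : ‖p‖ < 1) (k : ℤ) :
    recipPoch p k = (1 - p ^ (k + 1)) * recipPoch p (k + 1) := by
  rcases lt_trichotomy k (-1) with hk | rfl | hk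
  · rw [recipPoch_of_neg p (by lia), recipPoch_of_neg p (by lia), mul_zero]
  · simp [recipPoch]
  · lift k to ℕ using by lia
    have h := qPoch_self_ne_zero hp (k + 1)
    rw [← Nat.cast_succ, recipPoch_natCast, recipPoch_natCast, zpow_natCast]
    rw [qPoch_succ] at h ⊢
    have hk := left_ne_zero_of_mul h
    have hsucc := right_ne_zero_of_mul h
    rw [pow_succ]
    field_simp

theorem tendsto_recipPoch {p : ℂ} (hp : ‖p‖ < 1) :
    Tendsto (recipPoch p) atTop (𝓝 (qPochInf p p)⁻¹) := by
  have htoNat : Tendsto Int.toNat atTop atTop :=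
    tendsto_atTop_atTop.2 fun b => ⟨(b : ℤ), fun k hk => by lia⟩
  refine (((tendsto_qPoch p hp).inv₀ (qPochInf_ne_zero_of_norm_lt hp hp)).comp htoNat).congr' ?_
  filter_upwards [eventually_ge_atTop 0] with k hk
  simp [recipPoch, not_lt.2 hk]

theorem exists_norm_recipPoch_mul_le {p : ℂ} (hp : ‖p‖ < 1) :
    ∃ C, 0 ≤ C ∧ ∀ k l, ‖recipPoch p k * recipPoch p l‖ ≤ C := by
  obtain ⟨C, hC⟩ : ∃ C, ∀ k, ‖recipPoch p k‖ ≤ C := by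
    refine exists_norm_int_le
      (exists_norm_le_of_tendsto ((tendsto_recipPoch hp).comp tendsto_natCast_atTop_atTop))
      ⟨1, fun n => ?_⟩
    rcases n with _ | n
    · simp [recipPoch_zero]
    · rw [recipPoch_of_neg p (by lia), norm_zero]
      exact zero_le_one
  have hC0 : 0 ≤ C := (norm_nonneg _).trans (hC 0)
  refine ⟨C * C, mul_nonneg hC0 hC0, fun k l => ?_⟩
  rw [norm_mul]
  exact mul_le_mul (hC k) (hC l) (norm_nonneg _) hC0

/-- The bilateral Bailey transform `∑_r u_r / ((p; p)_{m-r} (p; p)_{n+r})` of a sequence `u`; only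
finitely many terms are nonzero, so no summability of `u` is required. -/
def baileySum (p : ℂ) (u : ℤ → ℂ) (m n : ℤ) : ℂ :=
  ∑' r : ℤ, u r * (recipPoch p (m - r) * recipPoch p (n + r))

theorem summable_baileySum (p : ℂ) (u : ℤ → ℂ) (m n : ℤ) :
    Summable fun r : ℤ => u r * (recipPoch p (m - r) * recipPoch p (n + r)) := by
  refine (hasSum_sum_of_ne_finset_zero (s := Finset.Icc (-n) m) fun r hr => ?_).summable
  rw [Finset.mem_Icc, not_and_or] at hr
  rcases hr with hr | hr
  · rw [recipPoch_of_neg p (show n + r < 0 by lia), mul_zero, mul_zero]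
  · rw [recipPoch_of_neg p (show m - r < 0 by lia), zero_mul, mul_zero]

theorem baileySum_zero_zero (p : ℂ) (u : ℤ → ℂ) : baileySum p u 0 0 = u 0 := by
  rw [baileySum, tsum_eq_single 0]
  · simp [recipPoch_zero]
  · intro r hr
    rcases hr.lt_or_gt with hr | hr
    · rw [recipPoch_of_neg p (show 0 + r < 0 by lia), mul_zero, mul_zero]
    · rw [recipPoch_of_neg p (show 0 - r < 0 by lia), zero_mul, mul_zero]

theorem baileySum_add (p : ℂ) (u v : ℤ → ℂ) (m n : ℤ) :
    baileySum p (fun r => u r + v r) m n = baileySum p u m n + baileySum p v m n := by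
  simp only [baileySum, add_mul]
  exact (summable_baileySum p u m n).tsum_add (summable_baileySum p v m n)

theorem baileySum_const_mul (p c : ℂ) (u : ℤ → ℂ) (m n : ℤ) :
    baileySum p (fun r => c * u r) m n = c * baileySum p u m n := by
  simp only [baileySum, mul_assoc, tsum_mul_left]

theorem baileySum_shift (p : ℂ) (u : ℤ → ℂ) (m n : ℤ) :
    baileySum p (fun r => u (r + 1)) m (n + 1) = baileySum p u (m + 1) n := by
  refine Eq.trans (tsum_congr fun r => ?_) ((Equiv.addRight (1 : ℤ)).tsum_eq _)
  rw [Equiv.coe_addRight]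
  rw [show m + 1 - (r + 1) = m - r by ring, show n + (r + 1) = n + 1 + r by ring]

theorem baileySum_reflect (p : ℂ) (u : ℤ → ℂ) (m n c : ℤ) :
    baileySum p (fun r => u (c - r)) m n = baileySum p u (n + c) (m - c) := by
  rw [baileySum, baileySum, ← (Equiv.subLeft c).tsum_eq]
  refine tsum_congr fun r => ?_
  simp only [Equiv.subLeft_apply, sub_sub_cancel]
  rw [mul_comm (recipPoch p _), show m - (c - r) = m - c + r by ring,
    show n + (c - r) = n + c - r by ring]

theorem baileySum_eq_sub_left {p : ℂ} (hp0 : p ≠ 0) (hp1 : ‖p‖ < 1) (u : ℤ → ℂ) (m n : ℤ) :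
    baileySum p u m n = baileySum p u (m + 1) n
      - p ^ (m + 1) * baileySum p (fun r => p ^ (-r) * u r) (m + 1) n := by
  simp only [baileySum]
  rw [← tsum_mul_left, ← (summable_baileySum p u (m + 1) n).tsum_sub
    ((summable_baileySum p _ (m + 1) n).mul_left _)]
  refine tsum_congr fun r => ?_
  rw [recipPoch_eq_mul_succ hp1 (m - r), show m - r + 1 = m + 1 - r by ring, sub_eq_add_neg _ r,
    zpow_add₀ hp0]
  ring

theorem baileySum_eq_sub_right {p : ℂ} (hp0 : p ≠ 0) (hp1 : ‖p‖ < 1) (u : ℤ → ℂ) (m n : ℤ) :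
    baileySum p u m n = baileySum p u m (n + 1)
      - p ^ (n + 1) * baileySum p (fun r => p ^ r * u r) m (n + 1) := by
  simp only [baileySum]
  rw [← tsum_mul_left, ← (summable_baileySum p u m (n + 1)).tsum_sub
    ((summable_baileySum p _ m (n + 1)).mul_left _)]
  refine tsum_congr fun r => ?_
  rw [recipPoch_eq_mul_succ hp1 (n + r), add_right_comm n r 1, zpow_add₀ hp0 (n + 1)]
  ring

theorem tendsto_baileySum {p : ℂ} (hp : ‖p‖ < 1) {u : ℤ → ℂ} (hu : Summable u) :
    Tendsto (fun n : ℕ => baileySum p u n n) atTop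
      (𝓝 ((∑' r, u r) * ((qPochInf p p)⁻¹ * (qPochInf p p)⁻¹))) := by
  obtain ⟨C, -, hC⟩ := exists_norm_recipPoch_mul_le hp
  rw [← tsum_mul_right]
  refine tendsto_tsum_of_dominated_convergence (hu.norm.mul_right C) (fun r => ?_)
    (Eventually.of_forall fun n r => ?_)
  · have hcast := tendsto_natCast_atTop_atTop (R := ℤ)
    have hsub : Tendsto (fun n : ℕ => (n : ℤ) - r) atTop atTop :=
      tendsto_atTop_add_const_right atTop (-r) hcast
    have hadd : Tendsto (fun n : ℕ => (n : ℤ) + r) atTop atTop :=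
      tendsto_atTop_add_const_right atTop r hcast
    exact (((tendsto_recipPoch hp).comp hsub).mul ((tendsto_recipPoch hp).comp hadd)).const_mul _
  · rw [norm_mul]
    gcongr
    exact hC _ _

/-- The general term `s^{r² - r} (-x)^r` of the theta series. With the nome `p = s²` it is
`(-1)^r p^{r(r-1)/2} x^r`; working with `s` keeps all exponents integral. -/
def thetaTerm (s x : ℂ) (r : ℤ) : ℂ := s ^ (r ^ 2 - r) * (-x) ^ r

theorem thetaTerm_zero (s x : ℂ) : thetaTerm s x 0 = 1 := by simp [thetaTerm]

theorem thetaTerm_mul (s x y : ℂ) (r : ℤ) : thetaTerm s (x * y) r = thetaTerm s x r * y ^ r := by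
  rw [thetaTerm, thetaTerm, ← neg_mul, mul_zpow, mul_assoc]

theorem thetaTerm_pow (s : ℂ) (a b : ℕ) (r : ℤ) :
    thetaTerm (s ^ a) (s ^ b) r = (-1) ^ r * (s ^ (a * (r ^ 2 - r)) * s ^ (b * r)) := by
  rw [thetaTerm, neg_eq_neg_one_mul, mul_zpow, zpow_mul, zpow_mul, zpow_natCast, zpow_natCast]
  ring

theorem thetaTerm_mul_zpow (s x : ℂ) (l r : ℤ) :
    thetaTerm s (x * (s ^ 2) ^ l) r = thetaTerm s x r * (s ^ 2) ^ (l * r) := by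
  rw [thetaTerm_mul, zpow_mul]

theorem thetaTerm_add {s x : ℂ} (hs0 : s ≠ 0) (hx : x ≠ 0) (r l : ℤ) :
    thetaTerm s x (r + l) = thetaTerm s x l * thetaTerm s (x * (s ^ 2) ^ l) r := by
  have hexp :
      s ^ ((r + l) ^ 2 - (r + l)) = s ^ (r ^ 2 - r) * s ^ (l ^ 2 - l) * (s ^ 2) ^ (l * r) := by
    rw [← zpow_natCast s, ← zpow_mul, ← zpow_add₀ hs0, ← zpow_add₀ hs0]
    push_cast
    ring_nf
  rw [thetaTerm_mul_zpow, thetaTerm, thetaTerm, thetaTerm, hexp, zpow_add₀ (neg_ne_zero.2 hx)]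
  ring

theorem thetaTerm_add_one {s x : ℂ} (hs0 : s ≠ 0) (hx : x ≠ 0) (r : ℤ) :
    thetaTerm s x (r + 1) = -x * ((s ^ 2) ^ r * thetaTerm s x r) := by
  rw [thetaTerm_add hs0 hx, thetaTerm_mul_zpow, one_mul, thetaTerm]
  simp only [one_pow, sub_self, zpow_zero, zpow_one, one_mul]
  ring

theorem summable_thetaTerm {s x : ℂ} (hs0 : s ≠ 0) (hs1 : ‖s‖ < 1) (hx : x ≠ 0) :
    Summable (thetaTerm s x) :=
  (summable_zpow_quadratic hs0 hs1 (neg_ne_zero.2 hx) one_pos (-1)).congr fun r => by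
    rw [thetaTerm]
    ring_nf

section

variable {s x z : ℂ}

theorem baileySum_thetaTerm_eq_add_left (hs0 : s ≠ 0) (hs1 : ‖s‖ < 1) (hx : x ≠ 0) (m n : ℤ) :
    baileySum (s ^ 2) (thetaTerm s x) m n = baileySum (s ^ 2) (thetaTerm s x) (m + 1) n
      + (s ^ 2) ^ m * x * baileySum (s ^ 2) (thetaTerm s x) m (n + 1) := by
  have hp0 : s ^ 2 ≠ 0 := pow_ne_zero 2 hs0
  have hweight : (fun r => (s ^ 2) ^ (-(r + 1)) * thetaTerm s x (r + 1))
      = fun r => -x / s ^ 2 * thetaTerm s x r := by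
    funext r
    rw [thetaTerm_add_one hs0 hx, zpow_neg, zpow_add_one₀ hp0]
    field_simp
  rw [baileySum_eq_sub_left hp0 (norm_pow_lt_one hs1 two_ne_zero),
    ← baileySum_shift _ (fun r => (s ^ 2) ^ (-r) * thetaTerm s x r), hweight,
    baileySum_const_mul, zpow_add_one₀ hp0]
  field_simp
  ring

theorem baileySum_thetaTerm_eq_add_right (hs0 : s ≠ 0) (hs1 : ‖s‖ < 1) (hx : x ≠ 0) (m n : ℤ) :
    baileySum (s ^ 2) (thetaTerm s x) m n = baileySum (s ^ 2) (thetaTerm s x) m (n + 1)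
      + (s ^ 2) ^ n * (s ^ 2 / x) * baileySum (s ^ 2) (thetaTerm s x) (m + 1) n := by
  have hp0 : s ^ 2 ≠ 0 := pow_ne_zero 2 hs0
  have hweight : (fun r => (s ^ 2) ^ r * thetaTerm s x r)
      = fun r => -x⁻¹ * thetaTerm s x (r + 1) := by
    funext r
    rw [thetaTerm_add_one hs0 hx]
    field_simp
  rw [baileySum_eq_sub_right hp0 (norm_pow_lt_one hs1 two_ne_zero), hweight,
    baileySum_const_mul, baileySum_shift, zpow_add_one₀ hp0]
  field_simp
  ring

theorem one_sub_mul_baileySum_thetaTerm_left (hs0 : s ≠ 0) (hs1 : ‖s‖ < 1) (hx : x ≠ 0)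
    (m n : ℤ) :
    (1 - (s ^ 2) ^ (m + n + 1)) * baileySum (s ^ 2) (thetaTerm s x) (m + 1) n
      = (1 - (s ^ 2) ^ m * x) * baileySum (s ^ 2) (thetaTerm s x) m n := by
  have hp0 : s ^ 2 ≠ 0 := pow_ne_zero 2 hs0
  have hleft := baileySum_thetaTerm_eq_add_left hs0 hs1 hx m n
  have hright := baileySum_thetaTerm_eq_add_right hs0 hs1 hx m n
  rw [zpow_add_one₀ hp0, zpow_add₀ hp0]
  field_simp at hright
  linear_combination -hleft + (s ^ 2) ^ m * hright

theorem one_sub_mul_baileySum_thetaTerm_right (hs0 : s ≠ 0) (hs1 : ‖s‖ < 1) (hx : x ≠ 0)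
    (m n : ℤ) :
    (1 - (s ^ 2) ^ (m + n + 1)) * baileySum (s ^ 2) (thetaTerm s x) m (n + 1)
      = (1 - (s ^ 2) ^ n * (s ^ 2 / x)) * baileySum (s ^ 2) (thetaTerm s x) m n := by
  have hp0 : s ^ 2 ≠ 0 := pow_ne_zero 2 hs0
  have hleft := baileySum_thetaTerm_eq_add_left hs0 hs1 hx m n
  have hright := baileySum_thetaTerm_eq_add_right hs0 hs1 hx m n
  rw [zpow_add_one₀ hp0, zpow_add₀ hp0]
  linear_combination -hright + (s ^ 2) ^ n * (s ^ 2 / x) * hleft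
    + (s ^ 2) ^ m * (s ^ 2) ^ n * s ^ 2 * baileySum (s ^ 2) (thetaTerm s x) m (n + 1)
      * (div_self hx)

theorem finite_jacobi_triple_product (hs0 : s ≠ 0) (hs1 : ‖s‖ < 1) (hx : x ≠ 0) (m n : ℕ) :
    baileySum (s ^ 2) (thetaTerm s x) m n
      = qPoch x (s ^ 2) m * qPoch (s ^ 2 / x) (s ^ 2) n * recipPoch (s ^ 2) (m + n) := by
  have hp1 : ‖s ^ 2‖ < 1 := norm_pow_lt_one hs1 two_ne_zero
  have hne (k : ℕ) : 1 - (s ^ 2) ^ ((k : ℤ) + 1) ≠ 0 :=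
    one_sub_ne_zero_of_norm_lt (mod_cast norm_pow_lt_one hp1 k.succ_ne_zero)
  induction m with
  | zero =>
    induction n with
    | zero => simp [baileySum_zero_zero, thetaTerm_zero, qPoch_zero, recipPoch_zero]
    | succ n ih =>
      refine mul_left_cancel₀ (hne n) ?_
      have hstep := one_sub_mul_baileySum_thetaTerm_right hs0 hs1 hx (0 : ℕ) n
      simp only [Nat.cast_zero, zero_add, zpow_natCast] at hstep ih ⊢
      rw [Nat.cast_succ, hstep, ih, qPoch_succ, recipPoch_eq_mul_succ hp1]
      ring
  | succ m ih =>
    refine mul_left_cancel₀ (hne (m + n)) ?_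
    have hstep := one_sub_mul_baileySum_thetaTerm_left hs0 hs1 hx m n
    rw [ih, zpow_natCast, recipPoch_eq_mul_succ hp1] at hstep
    push_cast
    rw [hstep, qPoch_succ, add_right_comm (m : ℤ) 1]
    ring

theorem jacobi_triple_product (hs0 : s ≠ 0) (hs1 : ‖s‖ < 1) (hx : x ≠ 0) :
    ∑' r, thetaTerm s x r = theta x (s ^ 2) := by
  have hp1 : ‖s ^ 2‖ < 1 := norm_pow_lt_one hs1 two_ne_zero
  have hP := qPochInf_ne_zero_of_norm_lt hp1 hp1
  have hsum := tendsto_baileySum hp1 (summable_thetaTerm hs0 hs1 hx)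
  simp_rw [finite_jacobi_triple_product hs0 hs1 hx] at hsum
  have hcast := tendsto_natCast_atTop_atTop (R := ℤ)
  have hprod := ((tendsto_qPoch x hp1).mul (tendsto_qPoch (s ^ 2 / x) hp1)).mul
    ((tendsto_recipPoch hp1).comp (hcast.atTop_add_atTop hcast))
  have hlim := tendsto_nhds_unique hsum hprod
  rw [theta]
  field_simp at hlim
  linear_combination hlim

theorem theta_mul_zpow (hs0 : s ≠ 0) (hs1 : ‖s‖ < 1) (hx : x ≠ 0) (l : ℤ) :
    theta x (s ^ 2) = thetaTerm s x l * theta (x * (s ^ 2) ^ l) (s ^ 2) := by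
  have hxl : x * (s ^ 2) ^ l ≠ 0 := mul_ne_zero hx (zpow_ne_zero l (pow_ne_zero 2 hs0))
  rw [← jacobi_triple_product hs0 hs1 hx, ← jacobi_triple_product hs0 hs1 hxl, ← tsum_mul_left,
    ← (Equiv.addRight l).tsum_eq]
  exact tsum_congr fun r => thetaTerm_add hs0 hx r l

theorem theta_zpow (hs0 : s ≠ 0) (hs1 : ‖s‖ < 1) (l : ℤ) : theta ((s ^ 2) ^ l) (s ^ 2) = 0 := by
  have hp1 : ‖s ^ 2‖ < 1 := norm_pow_lt_one hs1 two_ne_zero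
  have hone : theta 1 (s ^ 2) = 0 := by
    have hfactor : qPochInf 1 (s ^ 2) = 0 :=
      tendsto_nhds_unique ((tendsto_qPoch 1 hp1).comp (tendsto_add_atTop_nat 1))
        (tendsto_const_nhds.congr fun n => (qPoch_one_succ _ n).symm)
    rw [theta, hfactor, zero_mul, zero_mul]
  rw [theta_mul_zpow hs0 hs1 one_ne_zero l, one_mul, mul_eq_zero] at hone
  refine hone.resolve_left (mul_ne_zero (zpow_ne_zero _ hs0) (zpow_ne_zero _ ?_))
  norm_num

theorem baileySum_thetaTerm_one (hs0 : s ≠ 0) (hs1 : ‖s‖ < 1) (m n : ℕ) :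
    baileySum (s ^ 2) (thetaTerm s 1) (m + 1) n = 0 := by
  have h := finite_jacobi_triple_product hs0 hs1 one_ne_zero (m + 1) n
  rwa [qPoch_one_succ, zero_mul, zero_mul, Nat.cast_succ] at h

theorem baileySum_thetaTerm_sq (hs0 : s ≠ 0) (hs1 : ‖s‖ < 1) (m n : ℕ) :
    baileySum (s ^ 2) (thetaTerm s (s ^ 2)) m (n + 1) = 0 := by
  have hp0 : s ^ 2 ≠ 0 := pow_ne_zero 2 hs0
  have h := finite_jacobi_triple_product hs0 hs1 hp0 m (n + 1)
  rwa [div_self hp0, qPoch_one_succ, mul_zero, zero_mul, Nat.cast_succ] at h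

/-- The general term `s^{k² - k} (-y)^k / (1 - x s^{2k})` of the Appell–Lerch series. -/
def appellTerm (s y x : ℂ) (k : ℤ) : ℂ := thetaTerm s y k * (1 - x * (s ^ 2) ^ k)⁻¹

theorem appellTerm_sub {y : ℂ} {r : ℤ} (hr : 1 - x * (s ^ 2) ^ r ≠ 0) :
    appellTerm s y x r - x * ((s ^ 2) ^ r * appellTerm s y x r) = thetaTerm s y r := by
  rw [appellTerm]
  linear_combination thetaTerm s y r * mul_inv_cancel₀ hr

theorem baileySum_appellTerm_left (hs0 : s ≠ 0) (hs1 : ‖s‖ < 1)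
    (hz : ∀ k : ℤ, 1 - z * (s ^ 2) ^ k ≠ 0) (m n : ℕ) :
    baileySum (s ^ 2) (appellTerm s (s ^ 2) z) m n = (1 - (s ^ 2) ^ (m + 1) * z)
      * baileySum (s ^ 2) (appellTerm s (s ^ 2) z) (m + 1) n := by
  have hp0 : s ^ 2 ≠ 0 := pow_ne_zero 2 hs0
  have hweight : (fun r => (s ^ 2) ^ (-r) * appellTerm s (s ^ 2) z r)
      = fun r => thetaTerm s 1 r + z * appellTerm s (s ^ 2) z r := by
    funext r
    have htheta : thetaTerm s (s ^ 2) r = (s ^ 2) ^ r * thetaTerm s 1 r := by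
      simpa [mul_comm] using thetaTerm_mul_zpow s 1 1 r
    have hinv := zpow_neg_mul_zpow_self r hp0
    linear_combination (s ^ 2) ^ (-r) * (appellTerm_sub (y := s ^ 2) (hz r)).trans htheta
      + (thetaTerm s 1 r + z * appellTerm s (s ^ 2) z r) * hinv
  rw [baileySum_eq_sub_left hp0 (norm_pow_lt_one hs1 two_ne_zero), hweight, baileySum_add,
    baileySum_const_mul, baileySum_thetaTerm_one hs0 hs1]
  norm_cast
  ring

theorem baileySum_appellTerm_right (hs0 : s ≠ 0) (hs1 : ‖s‖ < 1) (hz0 : z ≠ 0)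
    (hz : ∀ k : ℤ, 1 - z * (s ^ 2) ^ k ≠ 0) (m n : ℕ) :
    baileySum (s ^ 2) (appellTerm s (s ^ 2) z) m n = (1 - (s ^ 2) ^ n * (s ^ 2 / z))
      * baileySum (s ^ 2) (appellTerm s (s ^ 2) z) m (n + 1) := by
  have hweight : (fun r => (s ^ 2) ^ r * appellTerm s (s ^ 2) z r)
      = fun r => z⁻¹ * appellTerm s (s ^ 2) z r + -z⁻¹ * thetaTerm s (s ^ 2) r := by
    funext r
    rw [← appellTerm_sub (hz r)]
    field_simp
    ring
  rw [baileySum_eq_sub_right (pow_ne_zero 2 hs0) (norm_pow_lt_one hs1 two_ne_zero), hweight,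
    baileySum_add, baileySum_const_mul, baileySum_const_mul, baileySum_thetaTerm_sq hs0 hs1]
  norm_cast
  ring

theorem finite_partial_fractions (hs0 : s ≠ 0) (hs1 : ‖s‖ < 1) (hz0 : z ≠ 0)
    (hz : ∀ k : ℤ, 1 - z * (s ^ 2) ^ k ≠ 0) (m n : ℕ) :
    qPoch z (s ^ 2) (m + 1) * qPoch (s ^ 2 / z) (s ^ 2) n
      * baileySum (s ^ 2) (appellTerm s (s ^ 2) z) m n = 1 := by
  induction m with
  | zero =>
    induction n with
    | zero =>
      simpa [baileySum_zero_zero, appellTerm, thetaTerm_zero, qPoch] using mul_inv_cancel₀ (hz 0)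
    | succ n ih =>
      rw [baileySum_appellTerm_right hs0 hs1 hz0 hz] at ih
      rw [← ih, qPoch_succ _ _ n, Nat.cast_succ]
      ring
  | succ m ih =>
    rw [baileySum_appellTerm_left hs0 hs1 hz] at ih
    rw [← ih, qPoch_succ _ _ (m + 1), Nat.cast_succ]
    ring

end

/-- The Appell–Lerch series `∑_k s^{k² - k} (-y)^k / (1 - x s^{2k})`. -/
def appellSum (s y x : ℂ) : ℂ := ∑' k, appellTerm s y x k

theorem summable_appellTerm {s y : ℂ} (hs0 : s ≠ 0) (hs1 : ‖s‖ < 1) (hy : y ≠ 0) (x : ℂ) :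
    Summable (appellTerm s y x) :=
  summable_mul_of_norm_le (summable_thetaTerm hs0 hs1 hy)
    (exists_norm_inv_one_sub_le x (pow_ne_zero 2 hs0) (norm_pow_lt_one hs1 two_ne_zero))

theorem theta_mul_appellSum {s z : ℂ} (hs0 : s ≠ 0) (hs1 : ‖s‖ < 1) (hz0 : z ≠ 0)
    (hz : ∀ k : ℤ, 1 - z * (s ^ 2) ^ k ≠ 0) :
    theta z (s ^ 2) * appellSum s (s ^ 2) z = qPochInf (s ^ 2) (s ^ 2) ^ 3 := by
  have hp1 : ‖s ^ 2‖ < 1 := norm_pow_lt_one hs1 two_ne_zero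
  have hP := qPochInf_ne_zero_of_norm_lt hp1 hp1
  have hprod := (((tendsto_qPoch z hp1).comp (tendsto_add_atTop_nat 1)).mul
    (tendsto_qPoch (s ^ 2 / z) hp1)).mul
      (tendsto_baileySum hp1 (summable_appellTerm hs0 hs1 (pow_ne_zero 2 hs0) z))
  have hlim := tendsto_nhds_unique
    (hprod.congr fun n => finite_partial_fractions hs0 hs1 hz0 hz n n) tendsto_const_nhds
  rw [theta, appellSum]
  field_simp at hlim
  linear_combination qPochInf (s ^ 2) (s ^ 2) * hlim

/-- The Durfee rectangle sum `∑_m p^{m² + km} / ((p; p)_m (p; p)_{m+k})`. -/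
def durfeeSum (p : ℂ) (k : ℤ) : ℂ :=
  ∑' m : ℤ, p ^ (m ^ 2 + k * m) * (recipPoch p m * recipPoch p (m + k))

section

variable {p : ℂ}

theorem summable_zpow_sq_add_mul (hp0 : p ≠ 0) (hp1 : ‖p‖ < 1) (k : ℤ) :
    Summable fun m : ℤ => p ^ (m ^ 2 + k * m) := by
  simpa using summable_zpow_quadratic hp0 hp1 one_ne_zero one_pos k

theorem summable_zpow_sq_mul_recipPoch (hp0 : p ≠ 0) (hp1 : ‖p‖ < 1) (k a b : ℤ) :
    Summable fun m : ℤ => p ^ (m ^ 2 + k * m) * (recipPoch p (m + a) * recipPoch p (m + b)) := by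
  obtain ⟨C, -, hC⟩ := exists_norm_recipPoch_mul_le hp1
  exact summable_mul_of_norm_le (summable_zpow_sq_add_mul hp0 hp1 k) ⟨C, fun m => hC _ _⟩

/-- The sum intermediate between `durfeeSum p k` and `durfeeSum p (k + 1)`: the weight of the former
with the denominators of the latter. -/
def mixedDurfeeSum (p : ℂ) (k : ℤ) : ℂ :=
  ∑' m : ℤ, p ^ (m ^ 2 + k * m) * (recipPoch p m * recipPoch p (m + (k + 1)))

theorem durfeeSum_eq_mixedDurfeeSum_sub (hp0 : p ≠ 0) (hp1 : ‖p‖ < 1) (k : ℤ) :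
    durfeeSum p k = mixedDurfeeSum p k - p ^ (k + 1) * durfeeSum p (k + 1) := by
  have h0 := summable_zpow_sq_mul_recipPoch hp0 hp1 k 0 (k + 1)
  have h1 := (summable_zpow_sq_mul_recipPoch hp0 hp1 (k + 1) 0 (k + 1)).mul_left (p ^ (k + 1))
  simp only [add_zero] at h0 h1
  rw [durfeeSum, mixedDurfeeSum, durfeeSum, ← tsum_mul_left, ← h0.tsum_sub h1]
  refine tsum_congr fun m => ?_
  rw [recipPoch_eq_mul_succ hp1 (m + k), add_assoc m k, add_mul k, ← add_assoc (m ^ 2), one_mul,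
    zpow_add₀ hp0 m (k + 1), zpow_add₀ hp0 _ m]
  ring

theorem mixedDurfeeSum_eq_durfeeSum_add (hp0 : p ≠ 0) (hp1 : ‖p‖ < 1) (k : ℤ) :
    mixedDurfeeSum p k = durfeeSum p (k + 1) + p ^ (k + 1) * durfeeSum p (k + 2) := by
  have h1 := summable_zpow_sq_mul_recipPoch hp0 hp1 (k + 1) 0 (k + 1)
  have h2 := summable_zpow_sq_mul_recipPoch hp0 hp1 k (-1) (k + 1)
  have hshift : p ^ (k + 1) * durfeeSum p (k + 2) = ∑' m : ℤ,
      p ^ (m ^ 2 + k * m) * (recipPoch p (m + -1) * recipPoch p (m + (k + 1))) := by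
    rw [durfeeSum, ← tsum_mul_left, ← (Equiv.addRight (1 : ℤ)).tsum_eq fun m : ℤ =>
      p ^ (m ^ 2 + k * m) * (recipPoch p (m + -1) * recipPoch p (m + (k + 1)))]
    refine tsum_congr fun m => ?_
    rw [Equiv.coe_addRight, add_neg_cancel_right, show m + 1 + (k + 1) = m + (k + 2) by ring,
      ← mul_assoc, ← zpow_add₀ hp0]
    ring_nf
  simp only [add_zero] at h1
  rw [hshift, mixedDurfeeSum, durfeeSum, ← h1.tsum_add h2]
  refine tsum_congr fun m => ?_
  rw [recipPoch_eq_mul_succ hp1 (m + -1), neg_add_cancel_right, add_mul k, ← add_assoc (m ^ 2),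
    one_mul, zpow_add₀ hp0 _ m]
  ring

theorem durfeeSum_sub_succ (hp0 : p ≠ 0) (hp1 : ‖p‖ < 1) (k : ℤ) :
    durfeeSum p k - durfeeSum p (k + 1)
      = -p ^ (k + 1) * (durfeeSum p (k + 1) - durfeeSum p (k + 2)) := by
  rw [durfeeSum_eq_mixedDurfeeSum_sub hp0 hp1, mixedDurfeeSum_eq_durfeeSum_add hp0 hp1]
  ring

theorem tendsto_durfeeSum (hp0 : p ≠ 0) (hp1 : ‖p‖ < 1) :
    Tendsto (fun n : ℕ => durfeeSum p n) atTop (𝓝 (qPochInf p p)⁻¹) := by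
  obtain ⟨C, hC0, hC⟩ := exists_norm_recipPoch_mul_le hp1
  have hlim (m : ℤ) :
      Tendsto (fun n : ℕ => p ^ (m ^ 2 + n * m) * (recipPoch p m * recipPoch p (m + n))) atTop
        (𝓝 (if m = 0 then (qPochInf p p)⁻¹ else 0)) := by
    have hrecip := (tendsto_recipPoch hp1).comp
      (tendsto_atTop_add_const_left _ m (tendsto_natCast_atTop_atTop (R := ℤ)))
    rcases lt_trichotomy m 0 with hm | rfl | hm
    · simp [recipPoch_of_neg p hm, hm.ne]
    · simpa [recipPoch_zero, Function.comp_def] using hrecip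
    · lift m to ℕ using hm.le
      have hpow := tendsto_pow_atTop_nhds_zero_of_norm_lt_one (norm_pow_lt_one hp1
        (Nat.cast_pos.1 hm).ne')
      rw [if_neg hm.ne']
      simpa [zpow_add₀ hp0, mul_comm _ (m : ℤ), zpow_mul] using
        (hpow.const_mul (p ^ (m : ℤ) ^ 2)).mul (hrecip.const_mul (recipPoch p m))
  have hbound (n : ℕ) (m : ℤ) :
      ‖p ^ (m ^ 2 + n * m) * (recipPoch p m * recipPoch p (m + n))‖ ≤ ‖p ^ (m ^ 2)‖ * C := by
    rcases lt_or_ge m 0 with hm | hm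
    · rw [recipPoch_of_neg p hm, zero_mul, mul_zero, norm_zero]
      positivity
    · lift m to ℕ using hm
      rw [norm_mul, zpow_add₀ hp0, norm_mul]
      refine mul_le_mul (mul_le_of_le_one_right (norm_nonneg _) ?_) (hC _ _) (norm_nonneg _)
        (norm_nonneg _)
      rw [← Nat.cast_mul, zpow_natCast, norm_pow]
      exact pow_le_one₀ (norm_nonneg _) hp1.le
  have hdom : Summable fun m : ℤ => ‖p ^ (m ^ 2)‖ * C := by
    simpa using (summable_zpow_sq_add_mul hp0 hp1 0).norm.mul_right C
  rw [← tsum_ite_eq (0 : ℤ) fun _ => (qPochInf p p)⁻¹]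
  exact tendsto_tsum_of_dominated_convergence hdom hlim (Eventually.of_forall hbound)

theorem durfeeSum_eq (hp0 : p ≠ 0) (hp1 : ‖p‖ < 1) (k : ℤ) :
    durfeeSum p k = (qPochInf p p)⁻¹ := by
  set d : ℤ → ℂ := fun k => durfeeSum p k - durfeeSum p (k + 1) with hd
  have hrec (k : ℤ) : d k = -p ^ (k + 1) * d (k + 1) := by
    simpa only [hd, add_assoc, one_add_one_eq_two] using durfeeSum_sub_succ hp0 hp1 k
  -- By the recurrence the norms `‖d n‖` increase, while they tend to `0`.
  have hd_nat (n : ℕ) : d n = 0 := by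
    have hmono : Monotone fun n : ℕ => ‖d n‖ := monotone_nat_of_le_succ fun n => by
      rw [hrec, norm_mul, norm_neg, ← Nat.cast_succ, zpow_natCast, norm_pow]
      exact mul_le_of_le_one_left (norm_nonneg _) (pow_le_one₀ (norm_nonneg _) hp1.le)
    have hlim := tendsto_durfeeSum hp0 hp1
    have hd_lim := (hlim.sub (hlim.comp (tendsto_add_atTop_nat 1))).norm
    rw [sub_self, norm_zero] at hd_lim
    refine norm_le_zero_iff.1 (hmono.ge_of_tendsto (hd_lim.congr fun n => ?_) n)
    simp [hd]
  have hd_zero (k : ℤ) : d k = 0 := by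
    obtain ⟨n, rfl | rfl⟩ := k.eq_nat_or_neg
    · exact hd_nat n
    · induction n with
      | zero => exact hd_nat 0
      | succ n ih => rw [hrec, Nat.cast_succ, neg_add, neg_add_cancel_right, ih, mul_zero]
  have hconst (k : ℤ) : durfeeSum p k = durfeeSum p 0 := by
    induction k with
    | zero => rfl
    | succ n ih => rw [← sub_eq_zero.1 (hd_zero n), ih]
    | pred n ih => rw [sub_eq_zero.1 (hd_zero (-n - 1)), sub_add_cancel, ih]
  rw [hconst]
  exact tendsto_nhds_unique (tendsto_const_nhds.congr fun n : ℕ => (hconst n).symm)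
    (tendsto_durfeeSum hp0 hp1)

theorem conjugate_bailey_pair (hp0 : p ≠ 0) (hp1 : ‖p‖ < 1) (k r : ℤ) :
    ∑' n : ℤ, p ^ (n ^ 2 + k * n) * (recipPoch p (n - r) * recipPoch p (n + k + r))
      = (qPochInf p p)⁻¹ * p ^ (r ^ 2 + k * r) := by
  rw [← durfeeSum_eq hp0 hp1 (k + 2 * r), durfeeSum, ← tsum_mul_right,
    ← (Equiv.addRight r).tsum_eq]
  refine tsum_congr fun m => ?_
  rw [Equiv.coe_addRight, add_sub_cancel_right, mul_right_comm, ← zpow_add₀ hp0]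
  ring_nf

theorem bailey_lemma (hp0 : p ≠ 0) (hp1 : ‖p‖ < 1) {u : ℤ → ℂ} (hu : Summable u) (k : ℤ) :
    ∑' n : ℤ, p ^ (n ^ 2 + k * n) * baileySum p u n (n + k)
      = (qPochInf p p)⁻¹ * ∑' r, p ^ (r ^ 2 + k * r) * u r := by
  obtain ⟨C, -, hC⟩ := exists_norm_recipPoch_mul_le hp1
  have hjoint : Summable fun i : ℤ × ℤ => p ^ (i.1 ^ 2 + k * i.1)
      * u i.2 * (recipPoch p (i.1 - i.2) * recipPoch p (i.1 + k + i.2)) := by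
    have hweight := summable_mul_of_summable_norm (summable_zpow_sq_add_mul hp0 hp1 k).norm hu.norm
    exact summable_mul_of_norm_le hweight ⟨C, fun i => hC _ _⟩
  have hcomm := hjoint.tsum_comm (f := fun n r => p ^ (n ^ 2 + k * n) * u r
    * (recipPoch p (n - r) * recipPoch p (n + k + r)))
  simp only [baileySum, ← tsum_mul_left, ← mul_assoc] at hcomm ⊢
  rw [← hcomm]
  refine tsum_congr fun r => ?_
  rw [← conjugate_bailey_pair hp0 hp1, ← tsum_mul_right]
  exact tsum_congr fun n => by ring

theorem baileySum_of_neg (u : ℤ → ℂ) {m n : ℤ} (h : m + n < 0) : baileySum p u m n = 0 := by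
  refine (tsum_congr fun r => ?_).trans tsum_zero
  rcases lt_or_ge m r with hr | hr
  · rw [recipPoch_of_neg p (show m - r < 0 by lia), zero_mul, mul_zero]
  · rw [recipPoch_of_neg p (show n + r < 0 by lia), mul_zero, mul_zero]

theorem bailey_lemma_nat (hp0 : p ≠ 0) (hp1 : ‖p‖ < 1) {u : ℤ → ℂ} (hu : Summable u) {k : ℕ}
    (hk : k ≤ 1) : ∑' n : ℕ, p ^ (n ^ 2 + k * n) * baileySum p u n (n + k)
      = (qPochInf p p)⁻¹ * ∑' r : ℤ, p ^ (r ^ 2 + k * r) * u r := by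
  rw [← bailey_lemma hp0 hp1 hu]
  refine Eq.trans (tsum_congr fun n => ?_) (Nat.cast_injective.tsum_eq fun n hn => ?_)
  · norm_cast
  · by_contra hneg
    have hn0 : n < 0 := by
      by_contra h
      exact hneg ⟨n.toNat, Int.toNat_of_nonneg (by lia)⟩
    exact hn (by simp only; rw [baileySum_of_neg u (by lia), mul_zero])

end

section

variable {s z : ℂ}

theorem pentagonal_number (hs0 : s ≠ 0) (hs1 : ‖s‖ < 1) :
    ∑' r : ℤ, (s ^ 2) ^ r ^ 2 * thetaTerm s (s ^ 2) r = qPochInf (s ^ 2) (s ^ 2) := by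
  have hp0 : s ^ 2 ≠ 0 := pow_ne_zero 2 hs0
  have hp1 : ‖s ^ 2‖ < 1 := norm_pow_lt_one hs1 two_ne_zero
  have hbailey := bailey_lemma_nat hp0 hp1 (summable_thetaTerm hs0 hs1 hp0) zero_le_one
  rw [tsum_eq_single 0] at hbailey
  · simp only [Nat.cast_zero, add_zero, zero_mul, baileySum_zero_zero, thetaTerm_zero, mul_one,
      zero_pow two_ne_zero, pow_zero] at hbailey
    rw [eq_comm, inv_mul_eq_one₀ (qPochInf_ne_zero_of_norm_lt hp1 hp1)] at hbailey
    exact hbailey.symm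
  · intro n hn
    obtain ⟨n, rfl⟩ := Nat.exists_eq_succ_of_ne_zero hn
    have hzero := baileySum_thetaTerm_sq hs0 hs1 (n + 1) n
    rw [← Nat.cast_succ] at hzero
    rw [Nat.cast_zero, add_zero, hzero, mul_zero]

/-- The level three Appell–Lerch sum `∑_r (-1)^r p^{3r(r+1)/2 + (k-1)r} / (1 - x p^r)`, `p = s²`,
through which the universal mock theta function is expressed for `k = 0` and `k = 1`. -/
def levelThreeSum (s x : ℂ) (k : ℕ) : ℂ :=
  ∑' r : ℤ, (s ^ 2) ^ (r ^ 2 + k * r) * appellTerm s (s ^ 2) x r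

theorem qPochInf_mul_one_add_g (hs0 : s ≠ 0) (hs1 : ‖s‖ < 1) (hz0 : z ≠ 0)
    (hz : ∀ k : ℤ, 1 - z * (s ^ 2) ^ k ≠ 0) :
    qPochInf (s ^ 2) (s ^ 2) * (1 + z * g z (s ^ 2)) = levelThreeSum s z 0 := by
  have hp0 : s ^ 2 ≠ 0 := pow_ne_zero 2 hs0
  have hp1 : ‖s ^ 2‖ < 1 := norm_pow_lt_one hs1 two_ne_zero
  have hbailey := bailey_lemma_nat hp0 hp1 (summable_appellTerm hs0 hs1 hp0 z) zero_le_one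
  have hterm (n : ℕ) : (s ^ 2) ^ (n ^ 2 + 0 * n)
        * baileySum (s ^ 2) (appellTerm s (s ^ 2) z) n (n + (0 : ℕ))
      = (s ^ 2) ^ n ^ 2 / (qPoch z (s ^ 2) (n + 1) * qPoch (s ^ 2 / z) (s ^ 2) n) := by
    have hone := finite_partial_fractions hs0 hs1 hz0 hz n n
    rw [zero_mul, add_zero, Nat.cast_zero, add_zero,
      eq_div_iff (left_ne_zero_of_mul_eq_one hone), mul_assoc, mul_comm (baileySum _ _ _ _),
      hone, mul_one]
  rw [tsum_congr hterm, eq_inv_mul_iff_mul_eq₀ (qPochInf_ne_zero_of_norm_lt hp1 hp1)] at hbailey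
  rw [levelThreeSum, ← hbailey, g, mul_inv_cancel_left₀ hz0, add_neg_cancel_left]

theorem qPochInf_mul_g (hs0 : s ≠ 0) (hs1 : ‖s‖ < 1) (hz0 : z ≠ 0)
    (hz : ∀ k : ℤ, 1 - z * (s ^ 2) ^ k ≠ 0) :
    qPochInf (s ^ 2) (s ^ 2) * g z (s ^ 2) = levelThreeSum s z 1 := by
  have hp0 : s ^ 2 ≠ 0 := pow_ne_zero 2 hs0
  have hp1 : ‖s ^ 2‖ < 1 := norm_pow_lt_one hs1 two_ne_zero
  have hsum {u : ℤ → ℂ} (hu : Summable u) : Summable fun r : ℤ => (s ^ 2) ^ r ^ 2 * u r := by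
    have hgauss := summable_zpow_sq_add_mul hp0 hp1 0
    simp only [zero_mul, add_zero] at hgauss
    exact summable_mul_of_norm_le hgauss ⟨_, fun r => hu.norm.le_tsum r fun _ _ => norm_nonneg _⟩
  have hzero := qPochInf_mul_one_add_g hs0 hs1 hz0 hz
  simp only [levelThreeSum, Nat.cast_zero, zero_mul, add_zero] at hzero
  have hterm (r : ℤ) : z * ((s ^ 2) ^ (r ^ 2 + (1 : ℕ) * r) * appellTerm s (s ^ 2) z r)
      = (s ^ 2) ^ r ^ 2 * appellTerm s (s ^ 2) z r - (s ^ 2) ^ r ^ 2 * thetaTerm s (s ^ 2) r := by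
    rw [← appellTerm_sub (hz r), Nat.cast_one, one_mul, zpow_add₀ hp0]
    ring
  refine mul_left_cancel₀ hz0 ?_
  rw [levelThreeSum, ← tsum_mul_left, tsum_congr hterm,
    (hsum (summable_appellTerm hs0 hs1 hp0 z)).tsum_sub (hsum (summable_thetaTerm hs0 hs1 hp0)),
    pentagonal_number hs0 hs1, ← hzero]
  ring

theorem appellSum_sub (hs0 : s ≠ 0) (hs1 : ‖s‖ < 1) {x y : ℂ} (hy : y ≠ 0)
    (hx : ∀ k : ℤ, 1 - x * (s ^ 2) ^ k ≠ 0) :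
    appellSum s y x - x * appellSum s (y * s ^ 2) x = theta y (s ^ 2) := by
  have hp0 : s ^ 2 ≠ 0 := pow_ne_zero 2 hs0
  rw [← jacobi_triple_product hs0 hs1 hy, appellSum, appellSum, ← tsum_mul_left,
    ← (summable_appellTerm hs0 hs1 hy x).tsum_sub
      ((summable_appellTerm hs0 hs1 (mul_ne_zero hy hp0) x).mul_left x)]
  refine tsum_congr fun r => ?_
  have hmul := thetaTerm_mul_zpow s y 1 r
  rw [zpow_one, one_mul] at hmul
  rw [← appellTerm_sub (hx r), appellTerm, appellTerm, hmul]
  ring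

theorem theta_mul_appellSum_zpow_neg (hs0 : s ≠ 0) (hs1 : ‖s‖ < 1) (hz0 : z ≠ 0)
    (hz : ∀ k : ℤ, 1 - z * (s ^ 2) ^ k ≠ 0) (b : ℤ) :
    theta z (s ^ 2) * appellSum s ((s ^ 2) ^ (-b)) z
      = z ^ (b + 1) * qPochInf (s ^ 2) (s ^ 2) ^ 3 := by
  have hp0 : s ^ 2 ≠ 0 := pow_ne_zero 2 hs0
  have hstep (b : ℤ) :
      appellSum s ((s ^ 2) ^ (-(b + 1))) z = z * appellSum s ((s ^ 2) ^ (-b)) z := by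
    have h := appellSum_sub hs0 hs1 (zpow_ne_zero (-(b + 1)) hp0) hz
    rwa [theta_zpow hs0 hs1, sub_eq_zero, ← zpow_add_one₀ hp0,
      show -(b + 1) + 1 = -b by ring] at h
  have hpow : appellSum s ((s ^ 2) ^ (-b)) z = z ^ (b + 1) * appellSum s (s ^ 2) z := by
    induction b with
    | zero => simpa using hstep (-1)
    | succ n ih => rw [hstep, ih, zpow_add_one₀ hz0 (n + 1), mul_comm _ z, mul_assoc]
    | pred n ih =>
      rw [← sub_add_cancel (-(n : ℤ)) 1, hstep, zpow_add_one₀ hz0 (-n - 1 + 1), mul_comm _ z,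
        mul_assoc] at ih
      exact mul_left_cancel₀ hz0 ih
  rw [hpow, mul_left_comm, theta_mul_appellSum hs0 hs1 hz0 hz]

end

section

variable {s w x y : ℂ} {c : ℕ}

theorem thetaTerm_mul_zpow_neg (hs0 : s ≠ 0) (hy : y ≠ 0) (b k : ℤ) :
    thetaTerm s (y * (s ^ 2) ^ (-b)) k
      = thetaTerm s y (k - b) * (s ^ (-b ^ 2 - b) * (-y) ^ b) := by
  have hexp : s ^ (k ^ 2 - k) * (s ^ 2) ^ (-b * k)
      = s ^ ((k - b) ^ 2 - (k - b)) * s ^ (-b ^ 2 - b) := by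
    rw [← zpow_natCast s, ← zpow_mul, ← zpow_add₀ hs0, ← zpow_add₀ hs0]
    push_cast
    ring_nf
  rw [thetaTerm_mul_zpow, thetaTerm, thetaTerm, mul_right_comm, hexp,
    mul_mul_mul_comm, ← zpow_add₀ (neg_ne_zero.2 hy), sub_add_cancel]

theorem summable_thetaTerm_mul_appellTerm (hs0 : s ≠ 0) (hs1 : ‖s‖ < 1) (hc : 2 ≤ c)
    (hw : w ≠ 0) (hy : y ≠ 0) (x : ℂ) :
    Summable fun i : ℤ × ℤ =>
      thetaTerm (s ^ c) w i.1 * appellTerm s (y * (s ^ 2) ^ (-i.1)) x i.2 := by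
  have hquad : Summable fun b : ℤ => thetaTerm (s ^ c) w b * (s ^ (-b ^ 2 - b) * (-y) ^ b) := by
    refine (summable_zpow_quadratic hs0 hs1 (mul_ne_zero hw hy) (Nat.sub_pos_of_lt hc)
      (-c - 1)).congr fun b => ?_
    have hexp : ((c - 1 : ℕ) : ℤ) * b ^ 2 + (-c - 1) * b = c * (b ^ 2 - b) + (-b ^ 2 - b) := by
      push_cast [one_le_two.trans hc]
      ring
    rw [hexp, zpow_add₀ hs0, zpow_mul, zpow_natCast, thetaTerm, ← neg_mul_neg w y, mul_zpow]
    ring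
  have hprod := summable_mul_of_summable_norm (summable_thetaTerm hs0 hs1 hy).norm hquad.norm
  have hshear : Function.Injective fun i : ℤ × ℤ => (i.2 - i.1, i.1) := by
    rintro ⟨b, k⟩ ⟨b', k'⟩ h
    simp only [Prod.mk.injEq] at h ⊢
    lia
  obtain ⟨C, hC⟩ := exists_norm_inv_one_sub_le x (pow_ne_zero 2 hs0)
    (norm_pow_lt_one hs1 two_ne_zero)
  refine (summable_mul_of_norm_le (hprod.comp_injective hshear) ⟨C, fun i => hC i.2⟩).congr
    fun i => ?_
  rw [appellTerm, thetaTerm_mul_zpow_neg hs0 hy]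
  simp only [Function.comp_apply]
  ring

theorem hasSum_appellTerm_mul_theta (hs0 : s ≠ 0) (hs1 : ‖s‖ < 1) (hc : 2 ≤ c)
    (hw : w ≠ 0) (hy : y ≠ 0) (x : ℂ) :
    HasSum (fun k => appellTerm s y x k * theta (w * (s ^ 2) ^ (-k)) ((s ^ c) ^ 2))
      (∑' b, thetaTerm (s ^ c) w b * appellSum s (y * (s ^ 2) ^ (-b)) x) := by
  have hsum := summable_thetaTerm_mul_appellTerm hs0 hs1 hc hw hy x
  have hcomm := hsum.tsum_comm
    (f := fun b k => thetaTerm (s ^ c) w b * appellTerm s (y * (s ^ 2) ^ (-b)) x k)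
  simp only [appellSum, ← tsum_mul_left]
  rw [← hcomm]
  refine hsum.prod_symm.prod.hasSum.congr_fun fun k => ?_
  have hwk : w * (s ^ 2) ^ (-k) ≠ 0 := mul_ne_zero hw (zpow_ne_zero _ (pow_ne_zero 2 hs0))
  rw [← jacobi_triple_product (pow_ne_zero c hs0) (norm_pow_lt_one hs1 (by lia)) hwk,
    ← tsum_mul_left]
  refine tsum_congr fun b => ?_
  have hexp : thetaTerm (s ^ c) (w * (s ^ 2) ^ (-k)) b
      = thetaTerm (s ^ c) w b * (s ^ 2) ^ (-b * k) := by
    rw [thetaTerm_mul, ← zpow_mul, neg_mul, neg_mul, mul_comm k]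
  simp only [Prod.fst_swap, Prod.snd_swap]
  rw [hexp, appellTerm, appellTerm, thetaTerm_mul_zpow]
  ring

theorem theta_mul_tsum_thetaTerm_mul_appellSum (hs0 : s ≠ 0) (hs1 : ‖s‖ < 1) (hc : c ≠ 0)
    (hw : w ≠ 0) (hx0 : x ≠ 0) (hx : ∀ k : ℤ, 1 - x * (s ^ 2) ^ k ≠ 0) :
    theta x (s ^ 2) * ∑' b, thetaTerm (s ^ c) w b * appellSum s ((s ^ 2) ^ (-b)) x
      = x * qPochInf (s ^ 2) (s ^ 2) ^ 3 * theta (w * x) ((s ^ c) ^ 2) := by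
  rw [← jacobi_triple_product (pow_ne_zero c hs0) (norm_pow_lt_one hs1 hc) (mul_ne_zero hw hx0),
    ← tsum_mul_left, ← tsum_mul_left]
  refine tsum_congr fun b => ?_
  rw [mul_left_comm, theta_mul_appellSum_zpow_neg hs0 hs1 hx0 hx, zpow_add_one₀ hx0,
    thetaTerm_mul]
  ring

theorem appellSum_reflect (hs0 : s ≠ 0) (hx : x ≠ 0) (hy : y ≠ 0) :
    appellSum s y x = y * (x * s ^ 2)⁻¹ * appellSum s (s ^ 2 / y) (x * s ^ 2)⁻¹ := by
  have hp0 : s ^ 2 ≠ 0 := pow_ne_zero 2 hs0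
  rw [appellSum, appellSum, ← tsum_mul_left, ← (Equiv.subLeft 1).tsum_eq]
  refine tsum_congr fun k => ?_
  have hk : (s ^ 2) ^ k ≠ 0 := zpow_ne_zero k hp0
  have hdenom : 1 - x * (s ^ 2) ^ (1 - k)
      = -(x * s ^ 2) * ((s ^ 2) ^ k)⁻¹ * (1 - (x * s ^ 2)⁻¹ * (s ^ 2) ^ k) := by
    rw [zpow_sub₀ hp0, zpow_one]
    field_simp
    ring
  have htheta : thetaTerm s y (1 - k) * (s ^ 2) ^ k = -y * thetaTerm s (s ^ 2 / y) k := by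
    rw [thetaTerm, thetaTerm, ← div_neg, div_zpow, zpow_sub₀ (neg_ne_zero.2 hy), zpow_one,
      show (1 - k) ^ 2 - (1 - k) = k ^ 2 - k by ring]
    ring
  rw [Equiv.subLeft_apply, appellTerm, appellTerm, hdenom, mul_inv, mul_inv, inv_inv, inv_neg]
  linear_combination -(x * s ^ 2)⁻¹ * (1 - (x * s ^ 2)⁻¹ * (s ^ 2) ^ k)⁻¹ * htheta

end

section

variable {q : ℂ}

theorem one_add_zpow_ne_zero (hq1 : ‖q‖ < 1) {k : ℤ} (hk : k ≠ 0) :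
    1 + q ^ k ≠ 0 := fun h => by
  have hnorm : ‖q‖ ^ k = 1 := by
    rw [← norm_zpow, ← neg_eq_of_add_eq_zero_right h, norm_neg, norm_one]
  exact hk ((zpow_eq_one_iff_right₀ (norm_nonneg q) hq1.ne).1 hnorm)

theorem one_sub_neg_inv_mul_zpow_ne_zero (hq0 : q ≠ 0) (hq1 : ‖q‖ < 1) (k : ℤ) :
    1 - -q⁻¹ * (q ^ 2) ^ k ≠ 0 := by
  have hexp : 1 - -q⁻¹ * (q ^ 2) ^ k = 1 + q ^ (2 * k - 1) := by
    rw [zpow_sub_one₀ hq0, zpow_mul, mul_comm _ q⁻¹, neg_mul, sub_neg_eq_add]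
    norm_cast
  rw [hexp]
  exact one_add_zpow_ne_zero hq1 (by lia)

/-- The two-sided sequence `α` whose Bailey sums are constant multiples of `1 / (-q; q)_{2n}` and
`1 / (-q; q)_{2n+1}`. -/
def psiBarAlpha (q : ℂ) (r : ℤ) : ℂ :=
  thetaTerm (q ^ 2) (q ^ 4) r * appellSum q (-1 * (q ^ 2) ^ (-r)) (-q⁻¹)

theorem psiBarAlpha_reflect (hq0 : q ≠ 0) (r : ℤ) :
    psiBarAlpha q (-1 - r) = -q * ((q ^ 2) ^ r * psiBarAlpha q r) := by
  have hp0 : q ^ 2 ≠ 0 := pow_ne_zero 2 hq0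
  have hbase : (-q⁻¹ * q ^ 2)⁻¹ = -q⁻¹ := by field_simp
  have hquot : q ^ 2 / (-1 * (q ^ 2) ^ (-r)) = -1 * (q ^ 2) ^ (-(-1 - r)) := by
    rw [show -(-1 - r) = r + 1 by ring, zpow_neg, zpow_add_one₀ hp0]
    field_simp
  have happell : appellSum q (-1 * (q ^ 2) ^ (-r)) (-q⁻¹)
      = (q ^ 2) ^ (-r) * q⁻¹ * appellSum q (-1 * (q ^ 2) ^ (-(-1 - r))) (-q⁻¹) := by
    rw [appellSum_reflect hq0 (neg_ne_zero.2 (inv_ne_zero hq0))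
      (mul_ne_zero (neg_ne_zero.2 one_ne_zero) (zpow_ne_zero _ hp0)), hbase, hquot]
    ring
  have htheta : thetaTerm (q ^ 2) (q ^ 4) (-1 - r) = -thetaTerm (q ^ 2) (q ^ 4) r := by
    have hexp : q ^ ((2 : ℕ) * ((-1 - r) ^ 2 - (-1 - r))) * q ^ ((4 : ℕ) * (-1 - r))
        = q ^ ((2 : ℕ) * (r ^ 2 - r)) * q ^ ((4 : ℕ) * r) := by
      rw [← zpow_add₀ hq0, ← zpow_add₀ hq0]
      push_cast
      ring_nf
    have hsign : (-1 : ℂ) ^ (-1 - r) = -(-1) ^ r := by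
      rw [zpow_sub₀ (neg_ne_zero.2 one_ne_zero), div_eq_mul_inv, ← inv_zpow]
      norm_num
    rw [thetaTerm_pow, thetaTerm_pow, hexp, hsign, neg_mul]
  have hinv := zpow_neg_mul_zpow_self r hp0
  rw [psiBarAlpha, psiBarAlpha, happell, htheta]
  linear_combination thetaTerm (q ^ 2) (q ^ 4) r
    * appellSum q (-1 * (q ^ 2) ^ (-(-1 - r))) (-q⁻¹) * (q * q⁻¹ * hinv + mul_inv_cancel₀ hq0)

theorem thetaTerm_mul_thetaTerm_neg_one (hq0 : q ≠ 0) (r : ℤ) :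
    thetaTerm (q ^ 2) (q ^ 4) r * thetaTerm q (-1 * (q ^ 2) ^ (-r)) r = thetaTerm q (q ^ 2) r := by
  have hexp : q ^ ((2 : ℕ) * (r ^ 2 - r)) * q ^ ((4 : ℕ) * r) * (q ^ (r ^ 2 - r)
      * q ^ ((2 : ℤ) * (-r * r))) = q ^ ((1 : ℕ) * (r ^ 2 - r)) * q ^ ((2 : ℕ) * r) := by
    simp only [← zpow_add₀ hq0]
    push_cast
    ring_nf
  have hright := thetaTerm_pow q 1 2 r
  rw [pow_one, ← hexp] at hright
  rw [thetaTerm_pow, thetaTerm_mul_zpow, hright, thetaTerm, neg_neg, one_zpow, zpow_mul q 2]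
  norm_cast
  ring

theorem psiBarAlpha_add (hq0 : q ≠ 0) (hq1 : ‖q‖ < 1) (r : ℤ) :
    psiBarAlpha q r + (q ^ 2) ^ r * psiBarAlpha q (-r)
      = theta (-1) (q ^ 2) * thetaTerm q (q ^ 2) r := by
  have hp0 : q ^ 2 ≠ 0 := pow_ne_zero 2 hq0
  have hy : -1 * (q ^ 2) ^ (-r) ≠ 0 :=
    mul_ne_zero (neg_ne_zero.2 one_ne_zero) (zpow_ne_zero _ hp0)
  have hrec := appellSum_sub hq0 hq1 hy (one_sub_neg_inv_mul_zpow_ne_zero hq0 hq1)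
  have hinv := zpow_neg_mul_zpow_self r hp0
  have hprev := psiBarAlpha_reflect hq0 (-r)
  have hstep : thetaTerm (q ^ 2) (q ^ 4) r
      = -((q ^ 2) ^ r * (q ^ 2) ^ r * thetaTerm (q ^ 2) (q ^ 4) (r - 1)) := by
    have h := thetaTerm_add_one hp0 (pow_ne_zero 4 hq0) (r - 1)
    rw [sub_add_cancel, zpow_sub_one₀ (pow_ne_zero 2 hp0), sq (q ^ 2), mul_zpow] at h
    rw [h]
    field_simp
  have hweight := thetaTerm_mul_thetaTerm_neg_one hq0 r
  rw [theta_mul_zpow hq0 hq1 hy r, mul_assoc, mul_assoc, hinv, mul_one, ← zpow_add_one₀ hp0,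
    show -r + 1 = -(r - 1) by ring] at hrec
  rw [show -1 - -r = r - 1 by ring, psiBarAlpha] at hprev
  rw [psiBarAlpha]
  linear_combination thetaTerm (q ^ 2) (q ^ 4) r * hrec + theta (-1) (q ^ 2) * hweight
    - q⁻¹ * appellSum q (-1 * (q ^ 2) ^ (-(r - 1))) (-q⁻¹) * hstep
    + q⁻¹ * ((q ^ 2) ^ r * (q ^ 2) ^ r) * hprev
    - (q ^ 2) ^ r * psiBarAlpha q (-r) * (q⁻¹ * q * hinv + inv_mul_cancel₀ hq0)

theorem baileySum_psiBarAlpha_even (hq0 : q ≠ 0) (hq1 : ‖q‖ < 1) (n : ℤ) :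
    baileySum (q ^ 2) (psiBarAlpha q) n n
      = (1 + q * (q ^ 2) ^ n) * baileySum (q ^ 2) (psiBarAlpha q) n (n + 1) := by
  have hp0 : q ^ 2 ≠ 0 := pow_ne_zero 2 hq0
  have hreflect := baileySum_reflect (q ^ 2) (psiBarAlpha q) n (n + 1) (-1)
  simp only [psiBarAlpha_reflect hq0] at hreflect
  rw [add_neg_cancel_right, sub_neg_eq_add, baileySum_const_mul] at hreflect
  rw [baileySum_eq_sub_right hp0 (norm_pow_lt_one hq1 two_ne_zero), zpow_add_one₀ hp0]
  linear_combination q * (q ^ 2) ^ n * hreflect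

theorem baileySum_psiBarAlpha_odd (hq0 : q ≠ 0) (hq1 : ‖q‖ < 1) (n : ℕ) :
    baileySum (q ^ 2) (psiBarAlpha q) n (n + 1) = (1 + (q ^ 2) ^ (n + 1))
      * baileySum (q ^ 2) (psiBarAlpha q) (n + 1) (n + 1) := by
  have hp0 : q ^ 2 ≠ 0 := pow_ne_zero 2 hq0
  let β : ℤ → ℂ := fun r => psiBarAlpha q r + (q ^ 2) ^ (-r) * psiBarAlpha q r
  have hpair (r : ℤ) : β r + β (0 - r) = theta (-1) (q ^ 2)
      * (thetaTerm q (q ^ 2) r + thetaTerm q 1 r) := by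
    have hone : thetaTerm q (q ^ 2) r = (q ^ 2) ^ r * thetaTerm q 1 r := by
      rw [mul_comm, ← thetaTerm_mul, one_mul]
    have hinv := zpow_neg_mul_zpow_self r hp0
    have hadd := psiBarAlpha_add hq0 hq1 r
    simp only [β, zero_sub, neg_neg]
    linear_combination (1 + (q ^ 2) ^ (-r)) * hadd + theta (-1) (q ^ 2) * (q ^ 2) ^ (-r) * hone
      + (theta (-1) (q ^ 2) * thetaTerm q 1 r - psiBarAlpha q (-r)) * hinv
  -- The Bailey transform at equal indices only sees the even part of `β`.
  have hvanish : baileySum (q ^ 2) β (n + 1) (n + 1) = 0 := by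
    have hreflect := baileySum_reflect (q ^ 2) β (n + 1) (n + 1) 0
    have hsum := baileySum_add (q ^ 2) β (fun r => β (0 - r)) (n + 1) (n + 1)
    have hone := baileySum_thetaTerm_one hq0 hq1 n (n + 1)
    have hsq := baileySum_thetaTerm_sq hq0 hq1 (n + 1) n
    push_cast at hone hsq
    rw [hreflect, add_zero, sub_zero, funext hpair, baileySum_const_mul, baileySum_add, hone, hsq,
      add_zero, mul_zero] at hsum
    linear_combination -hsum / 2
  rw [baileySum_add] at hvanish
  rw [baileySum_eq_sub_left hp0 (norm_pow_lt_one hq1 two_ne_zero)]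
  norm_cast at hvanish ⊢
  linear_combination -(q ^ 2) ^ (n + 1) * hvanish

theorem qPoch_mul_baileySum_psiBarAlpha (hq0 : q ≠ 0) (hq1 : ‖q‖ < 1) (n : ℕ) :
    qPoch (-q) q (2 * n) * baileySum (q ^ 2) (psiBarAlpha q) n n = theta (-1) (q ^ 2) / 2 := by
  induction n with
  | zero =>
    have hzero := psiBarAlpha_add hq0 hq1 0
    simp only [neg_zero, zpow_zero, one_mul, thetaTerm_zero, mul_one] at hzero
    rw [mul_zero, qPoch_zero, Nat.cast_zero, baileySum_zero_zero]
    linear_combination hzero / 2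
  | succ n ih =>
    rw [baileySum_psiBarAlpha_even hq0 hq1, baileySum_psiBarAlpha_odd hq0 hq1] at ih
    rw [← ih, mul_add_one, qPoch_succ, qPoch_succ, Nat.cast_succ, zpow_natCast]
    ring

theorem qPoch_mul_baileySum_psiBarAlpha_of_le_one (hq0 : q ≠ 0) (hq1 : ‖q‖ < 1) (n : ℕ) {k : ℕ}
    (hk : k ≤ 1) : qPoch (-q) q (2 * n + k) * baileySum (q ^ 2) (psiBarAlpha q) n (n + k)
      = theta (-1) (q ^ 2) / 2 := by
  have heven := qPoch_mul_baileySum_psiBarAlpha hq0 hq1 n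
  interval_cases k
  · simpa using heven
  · rw [baileySum_psiBarAlpha_even hq0 hq1, zpow_natCast] at heven
    rw [← heven, qPoch_succ, Nat.cast_one]
    ring

theorem qPoch_neg_self_ne_zero (hq1 : ‖q‖ < 1) (n : ℕ) : qPoch (-q) q n ≠ 0 := by
  refine Finset.prod_ne_zero_iff.2 fun i _ => one_sub_ne_zero_of_norm_lt ?_
  rw [mul_neg, norm_neg, ← pow_succ]
  exact norm_pow_lt_one hq1 i.succ_ne_zero

theorem summable_psiBarAlpha (hq0 : q ≠ 0) (hq1 : ‖q‖ < 1) : Summable (psiBarAlpha q) := by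
  refine (summable_thetaTerm_mul_appellTerm hq0 hq1 le_rfl (pow_ne_zero 4 hq0)
    (neg_ne_zero.2 one_ne_zero) (-q⁻¹)).prod.congr fun r => ?_
  rw [psiBarAlpha, appellSum, ← tsum_mul_left]

/-- The Hecke-type double sum obtained by inserting `psiBarAlpha` (`y = -1`) into Bailey's lemma,
with the argument `y` of the inner Appell–Lerch sum left free. -/
def psiBarDoubleSum (q : ℂ) (k : ℕ) (y : ℂ) : ℂ :=
  ∑' r, thetaTerm (q ^ 4) (q ^ (6 + 2 * k)) r * appellSum q (y * (q ^ 2) ^ (-r)) (-q⁻¹)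

theorem theta_mul_tsum_psiBar (hq0 : q ≠ 0) (hq1 : ‖q‖ < 1) {k : ℕ} (hk : k ≤ 1) :
    theta (-1) (q ^ 2) * qPochInf (q ^ 2) (q ^ 2)
        * ∑' n : ℕ, q ^ (2 * n ^ 2 + 2 * k * n) / qPoch (-q) q (2 * n + k)
      = 2 * psiBarDoubleSum q k (-1) := by
  have hp1 : ‖q ^ 2‖ < 1 := norm_pow_lt_one hq1 two_ne_zero
  have hbailey := bailey_lemma_nat (pow_ne_zero 2 hq0) hp1 (summable_psiBarAlpha hq0 hq1) hk
  have hterm (n : ℕ) : (q ^ 2) ^ (n ^ 2 + k * n) * baileySum (q ^ 2) (psiBarAlpha q) n (n + k)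
      = theta (-1) (q ^ 2) / 2 * (q ^ (2 * n ^ 2 + 2 * k * n) / qPoch (-q) q (2 * n + k)) := by
    have hne := qPoch_neg_self_ne_zero hq1 (2 * n + k)
    rw [← qPoch_mul_baileySum_psiBarAlpha_of_le_one hq0 hq1 n hk]
    field_simp
    ring
  have hweight (r : ℤ) : (q ^ 2) ^ (r ^ 2 + k * r) * psiBarAlpha q r
      = thetaTerm (q ^ 4) (q ^ (6 + 2 * k)) r * appellSum q (-1 * (q ^ 2) ^ (-r)) (-q⁻¹) := by
    have hexp : (q ^ 2) ^ (r ^ 2 + k * r)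
        * (q ^ ((2 : ℕ) * (r ^ 2 - r)) * q ^ ((4 : ℕ) * r))
        = q ^ ((4 : ℕ) * (r ^ 2 - r)) * q ^ ((6 + 2 * k : ℕ) * r) := by
      rw [← zpow_natCast q 2, ← zpow_mul]
      simp only [← zpow_add₀ hq0]
      push_cast
      ring_nf
    rw [psiBarAlpha, thetaTerm_pow, thetaTerm_pow, ← hexp]
    ring
  rw [tsum_congr hterm, tsum_congr hweight, tsum_mul_left,
    eq_inv_mul_iff_mul_eq₀ (qPochInf_ne_zero_of_norm_lt hp1 hp1)] at hbailey
  rw [psiBarDoubleSum]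
  linear_combination 2 * hbailey

end

section

variable {p q : ℂ}

theorem qPochInf_eq_mul (hp : ‖p‖ < 1) (x : ℂ) :
    qPochInf x p = (1 - x) * qPochInf (p * x) p := by
  have hmul : Multipliable fun i : ℕ => 1 - p ^ (i + 1) * x :=
    (multipliable_qPochInf (p * x) hp).congr fun i => by ring
  rw [qPochInf, tprod_eq_zero_mul' (f := fun i => 1 - p ^ i * x) hmul, qPochInf, pow_zero, one_mul]
  exact congrArg _ (tprod_congr fun i => by ring)

theorem qPochInf_mul_neg (hp : ‖p‖ < 1) (x : ℂ) :
    qPochInf x p * qPochInf (-x) p = qPochInf (x ^ 2) (p ^ 2) := by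
  rw [qPochInf, qPochInf,
    ← (multipliable_qPochInf x hp).tprod_mul (multipliable_qPochInf (-x) hp)]
  exact tprod_congr fun i => by ring

theorem qPochInf_even_mul_odd (hp : ‖p‖ < 1) (x : ℂ) :
    qPochInf x (p ^ 2) * qPochInf (p * x) (p ^ 2) = qPochInf x p := by
  have hp2 := norm_pow_lt_one hp two_ne_zero
  have heven (i : ℕ) : 1 - (p ^ 2) ^ i * x = 1 - p ^ (2 * i) * x := by rw [pow_mul]
  have hodd (i : ℕ) : 1 - (p ^ 2) ^ i * (p * x) = 1 - p ^ (2 * i + 1) * x := by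
    ring
  rw [qPochInf, qPochInf, qPochInf, tprod_congr heven, tprod_congr hodd]
  exact tprod_even_mul_odd (f := fun i => 1 - p ^ i * x)
    ((multipliable_qPochInf x hp2).congr heven) ((multipliable_qPochInf (p * x) hp2).congr hodd)

theorem theta_div (hp : p ≠ 0) (x : ℂ) : theta (p / x) p = theta x p := by
  rw [theta, theta, div_div_cancel₀ hp]
  ring

theorem theta_neg_one (hp : ‖p‖ < 1) :
    theta (-1) p = 2 * qPochInf (-p) p ^ 2 * qPochInf p p := by
  rw [theta, qPochInf_eq_mul hp, div_neg, div_one, mul_neg_one]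
  ring

theorem theta_sq (hq0 : q ≠ 0) :
    theta q (q ^ 2) = qPochInf q (q ^ 2) ^ 2 * qPochInf (q ^ 2) (q ^ 2) := by
  rw [theta, sq q, mul_div_cancel_right₀ q hq0]
  ring

theorem qPochInf_neg_mul_odd (hq1 : ‖q‖ < 1) :
    qPochInf (-q ^ 2) (q ^ 2) * qPochInf q (q ^ 2) * qPochInf (-q) (q ^ 2) = 1 := by
  have hp := norm_pow_lt_one hq1 two_ne_zero
  have hodd := qPochInf_mul_neg hp q
  have heven := qPochInf_mul_neg hp (q ^ 2)
  have hall := qPochInf_even_mul_odd hp (q ^ 2)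
  rw [← sq, ← heven] at hall
  refine mul_right_cancel₀ (qPochInf_ne_zero_of_norm_lt hp hp) ?_
  linear_combination qPochInf (-q ^ 2) (q ^ 2) * qPochInf (q ^ 2) (q ^ 2) * hodd + hall

theorem theta_neg_one_mul_theta_neg_mul_theta (hq0 : q ≠ 0) (hq1 : ‖q‖ < 1) :
    theta (-1) (q ^ 2) * theta (-q) (q ^ 2) * theta q (q ^ 2)
      = 2 * qPochInf (q ^ 2) (q ^ 2) ^ 3 := by
  have heuler := qPochInf_neg_mul_odd hq1
  have hneg := theta_sq (neg_ne_zero.2 hq0)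
  rw [neg_sq] at hneg
  rw [theta_neg_one (norm_pow_lt_one hq1 two_ne_zero), theta_sq hq0, hneg]
  linear_combination 2 * qPochInf (q ^ 2) (q ^ 2) ^ 3 *
    (qPochInf (-q ^ 2) (q ^ 2) * qPochInf q (q ^ 2) * qPochInf (-q) (q ^ 2) + 1) * heuler

theorem two_mul_theta_mul_qPochInf (hp0 : p ≠ 0) (hp : ‖p‖ < 1) :
    2 * theta (p ^ 2) ((p ^ 2) ^ 2) * qPochInf ((p ^ 2) ^ 2) ((p ^ 2) ^ 2)
      = theta (-1) p * qPochInf p p := by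
  have hsplit := qPochInf_even_mul_odd (norm_pow_lt_one hp two_ne_zero) (p ^ 2)
  rw [← sq, ← qPochInf_mul_neg hp p] at hsplit
  rw [theta_sq (pow_ne_zero 2 hp0), theta_neg_one hp]
  linear_combination 2 * (qPochInf (p ^ 2) ((p ^ 2) ^ 2)
    * qPochInf ((p ^ 2) ^ 2) ((p ^ 2) ^ 2) + qPochInf p p * qPochInf (-p) p) * hsplit

theorem Jm_eq_qPochInf (m : ℕ) (q : ℂ) : Jm m q = qPochInf (q ^ m) (q ^ m) :=
  tprod_congr fun i => by rw [← pow_succ, ← pow_mul]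

end

section

variable {q : ℂ}

theorem theta_mul_zpow_neg_self (hq0 : q ≠ 0) (hq1 : ‖q‖ < 1) (l : ℤ) :
    theta (q * (q ^ 2) ^ (-l)) (q ^ 2) = (-1) ^ l * q ^ (-l ^ 2) * theta q (q ^ 2) := by
  have hp0 : q ^ 2 ≠ 0 := pow_ne_zero 2 hq0
  have hcancel : q * (q ^ 2) ^ (-l) * (q ^ 2) ^ l = q := by
    rw [mul_assoc, zpow_neg_mul_zpow_self l hp0, mul_one]
  have hexp : q ^ (l ^ 2 - l) * q ^ l * (q ^ 2) ^ (-l * l) = q ^ (-l ^ 2) := by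
    simp only [← zpow_natCast, ← zpow_mul, ← zpow_add₀ hq0]
    push_cast
    ring_nf
  rw [theta_mul_zpow hq0 hq1 (mul_ne_zero hq0 (zpow_ne_zero _ hp0)) l, hcancel,
    thetaTerm_mul_zpow, thetaTerm, neg_eq_neg_one_mul, mul_zpow, ← hexp]
  ring

theorem appellTerm_one (s x : ℂ) (j : ℤ) :
    appellTerm s 1 x j = (-1) ^ j * appellTerm s (-1) x j := by
  rw [appellTerm, appellTerm, thetaTerm, thetaTerm, neg_neg, one_zpow]
  ring

theorem appellTerm_mul_theta_four_mul_add (hq0 : q ≠ 0) (hq1 : ‖q‖ < 1) (k : ℕ) (l : ℤ) :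
    appellTerm q (-1) (-q⁻¹) (4 * l + (k + 1))
        * theta (q ^ (6 + 2 * k) * (q ^ 2) ^ (-(4 * l + (k + 1)))) ((q ^ 4) ^ 2)
      = theta (q ^ 4) ((q ^ 4) ^ 2) * q ^ (k ^ 2 + k) * (((q ^ 4) ^ 2) ^ (l ^ 2 + k * l)
        * appellTerm (q ^ 4) ((q ^ 4) ^ 2) (-q ^ (2 * k + 1)) l) := by
  have harg : q ^ (6 + 2 * k) * (q ^ 2) ^ (-(4 * l + (k + 1)))
      = q ^ 4 * ((q ^ 4) ^ 2) ^ (-l) := by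
    simp only [← zpow_natCast, ← zpow_mul, ← zpow_add₀ hq0]
    push_cast
    ring_nf
  have hdenom : -q⁻¹ * (q ^ 2) ^ (4 * l + (k + 1)) = -q ^ (2 * k + 1) * ((q ^ 4) ^ 2) ^ l := by
    rw [neg_mul, neg_mul, ← zpow_neg_one]
    simp only [← zpow_natCast, ← zpow_mul, ← zpow_add₀ hq0]
    push_cast
    ring_nf
  have hexp : q ^ ((4 * l + (k + 1)) ^ 2 - (4 * l + (k + 1))) * (q ^ 4) ^ (-l ^ 2)
      = q ^ (k ^ 2 + k) * ((q ^ 4) ^ 2) ^ (l ^ 2 + k * l)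
        * (q ^ ((4 : ℕ) * (l ^ 2 - l)) * q ^ ((8 : ℕ) * l)) := by
    simp only [← zpow_natCast, ← zpow_mul, ← zpow_add₀ hq0]
    push_cast
    ring_nf
  have hterm := thetaTerm_pow q 4 8 l
  rw [show 8 = 4 * 2 from rfl, pow_mul q 4 2] at hterm
  rw [harg, theta_mul_zpow_neg_self (pow_ne_zero 4 hq0) (norm_pow_lt_one hq1 four_ne_zero),
    appellTerm, appellTerm, hdenom, hterm, thetaTerm, neg_neg, one_zpow, mul_one]
  linear_combination (-1) ^ l * theta (q ^ 4) ((q ^ 4) ^ 2)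
    * (1 - -q ^ (2 * k + 1) * ((q ^ 4) ^ 2) ^ l)⁻¹ * hexp

theorem theta_mul_zpow_eq_zero (hq0 : q ≠ 0) (hq1 : ‖q‖ < 1) (k : ℕ) (l : ℤ) :
    theta (q ^ (6 + 2 * k) * (q ^ 2) ^ (-(4 * l + (k + 3)))) ((q ^ 4) ^ 2) = 0 := by
  have harg : q ^ (6 + 2 * k) * (q ^ 2) ^ (-(4 * l + (k + 3))) = ((q ^ 4) ^ 2) ^ (-l) := by
    simp only [← zpow_natCast, ← zpow_mul, ← zpow_add₀ hq0]
    push_cast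
    ring_nf
  rw [harg, theta_zpow (pow_ne_zero 4 hq0) (norm_pow_lt_one hq1 four_ne_zero)]

theorem psiBarDoubleSum_neg_one_sub (hq0 : q ≠ 0) (hq1 : ‖q‖ < 1) (k : ℕ) :
    psiBarDoubleSum q k (-1) - (-1) ^ k * psiBarDoubleSum q k 1
      = 2 * theta (q ^ 4) ((q ^ 4) ^ 2) * q ^ (k ^ 2 + k)
        * levelThreeSum (q ^ 4) (-q ^ (2 * k + 1)) k := by
  let f (j : ℤ) : ℂ := appellTerm q (-1) (-q⁻¹) j
    * theta (q ^ (6 + 2 * k) * (q ^ 2) ^ (-j)) ((q ^ 4) ^ 2)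
  have hsum (y : ℂ) (hy : y ≠ 0) := hasSum_appellTerm_mul_theta (c := 4) hq0 hq1 (by norm_num)
    (pow_ne_zero (6 + 2 * k) hq0) hy (-q⁻¹)
  have hdiff := (hsum (-1) (neg_ne_zero.2 one_ne_zero)).sub
    ((hsum 1 one_ne_zero).mul_left ((-1) ^ k))
  have hcoeff (j : ℤ) : appellTerm q (-1) (-q⁻¹) j
        * theta (q ^ (6 + 2 * k) * (q ^ 2) ^ (-j)) ((q ^ 4) ^ 2)
      - (-1) ^ k * (appellTerm q 1 (-q⁻¹) j
        * theta (q ^ (6 + 2 * k) * (q ^ 2) ^ (-j)) ((q ^ 4) ^ 2))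
      = (1 - (-1) ^ (j + k)) * f j := by
    rw [appellTerm_one, zpow_add₀ (neg_ne_zero.2 one_ne_zero), zpow_natCast]
    ring
  have hinj : Function.Injective fun l : ℤ => 4 * l + (k + 1) := fun l l' h => by
    simpa using h
  -- The sign factor kills `j ≡ k` modulo 2, the theta function kills `j ≡ k + 3` modulo 4.
  have hsupp : Function.support (fun j : ℤ => (1 - (-1) ^ (j + k)) * f j)
      ⊆ Set.range fun l : ℤ => 4 * l + (k + 1 : ℤ) := by
    intro j hj
    obtain ⟨hsign, hterm⟩ := mul_ne_zero_iff.1 hj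
    have hodd : ¬Even (j + k) := fun h => hsign (by rw [h.neg_one_zpow, sub_self])
    have hclass (l : ℤ) : 4 * l + (k + 3) ≠ j := by
      rintro rfl
      exact right_ne_zero_of_mul hterm (theta_mul_zpow_eq_zero hq0 hq1 k l)
    refine ⟨(j - k - 1) / 4, ?_⟩
    have := hclass ((j - k - 3) / 4)
    grind
  rw [psiBarDoubleSum, psiBarDoubleSum, levelThreeSum, ← hdiff.tsum_eq, tsum_congr hcoeff,
    ← hinj.tsum_eq hsupp, ← tsum_mul_left]
  refine tsum_congr fun l => ?_
  have hodd : Odd (4 * l + (k + 1) + k) := ⟨2 * l + k, by ring⟩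
  rw [hodd.neg_one_zpow]
  linear_combination 2 * appellTerm_mul_theta_four_mul_add hq0 hq1 k l

theorem theta_neg_mul_psiBarDoubleSum_one (hq0 : q ≠ 0) (hq1 : ‖q‖ < 1) (k : ℕ) :
    theta (-q) (q ^ 2) * psiBarDoubleSum q k 1
      = -(qPochInf (q ^ 2) (q ^ 2) ^ 3 * theta (-q ^ (5 + 2 * k)) ((q ^ 4) ^ 2)) := by
  have hx0 : -q⁻¹ ≠ 0 := neg_ne_zero.2 (inv_ne_zero hq0)
  have hshift := theta_mul_zpow hq0 hq1 hx0 1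
  have hbase : -q⁻¹ * (q ^ 2) ^ (1 : ℤ) = -q := by
    rw [zpow_one]
    field_simp
  have harg : q ^ (6 + 2 * k) * -q⁻¹ = -q ^ (5 + 2 * k) := by
    rw [show 6 + 2 * k = 5 + 2 * k + 1 by ring, pow_succ, mul_neg, mul_inv_cancel_right₀ hq0]
  have hsum := theta_mul_tsum_thetaTerm_mul_appellSum hq0 hq1 four_ne_zero
    (pow_ne_zero (6 + 2 * k) hq0) hx0 (one_sub_neg_inv_mul_zpow_ne_zero hq0 hq1)
  have hterm : thetaTerm q (-q⁻¹) 1 = q⁻¹ := by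
    rw [thetaTerm, neg_neg, zpow_one]
    norm_num
  rw [hshift, hbase, hterm, harg] at hsum
  simp only [psiBarDoubleSum, one_mul]
  refine mul_left_cancel₀ (inv_ne_zero hq0) ?_
  linear_combination hsum

theorem Jm_eight (q : ℂ) : Jm 8 q = qPochInf ((q ^ 4) ^ 2) ((q ^ 4) ^ 2) := by
  rw [Jm_eq_qPochInf, pow_mul q 4 2]

theorem Jbar_three_sub (hq0 : q ≠ 0) (k : ℕ) :
    Jbar (3 - 2 * k) 8 q = theta (-q ^ (5 + 2 * k)) ((q ^ 4) ^ 2) := by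
  have hquot : q ^ 8 / q ^ (3 - 2 * k : ℤ) = q ^ (5 + 2 * k) := by
    rw [← zpow_natCast, ← zpow_natCast, ← zpow_sub₀ hq0]
    push_cast
    ring_nf
  rw [Jbar, ← theta_div (pow_ne_zero 8 hq0), div_neg, hquot, ← pow_mul q 4 2]

theorem tsum_psiBar_eq (hq0 : q ≠ 0) (hq1 : ‖q‖ < 1) {k : ℕ} (hk : k ≤ 1) :
    ∑' n : ℕ, q ^ (2 * n ^ 2 + 2 * k * n) / qPoch (-q) q (2 * n + k)
      = 2 * q ^ (k ^ 2 + k) * (levelThreeSum (q ^ 4) (-q ^ (2 * k + 1)) k / Jm 8 q)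
        - (-1) ^ k * (J 1 2 q * Jbar (3 - 2 * k) 8 q / Jm 2 q) := by
  have hp1 : ‖q ^ 2‖ < 1 := norm_pow_lt_one hq1 two_ne_zero
  have hP := qPochInf_ne_zero_of_norm_lt hp1 hp1
  have hE : Jm 8 q ≠ 0 := Jm_ne_zero (by norm_num) hq1
  have hprod := theta_neg_one_mul_theta_neg_mul_theta hq0 hq1
  have hthetas : theta (-1) (q ^ 2) * theta (-q) (q ^ 2) ≠ 0 :=
    left_ne_zero_of_mul (hprod ▸ mul_ne_zero two_ne_zero (pow_ne_zero 3 hP))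
  have hdouble := two_mul_theta_mul_qPochInf (pow_ne_zero 2 hq0) hp1
  rw [show (q ^ 2) ^ 2 = q ^ 4 by ring, ← Jm_eight] at hdouble
  have hbailey := theta_mul_tsum_psiBar hq0 hq1 hk
  have hdissect := psiBarDoubleSum_neg_one_sub hq0 hq1 k
  have hdiag := theta_neg_mul_psiBarDoubleSum_one hq0 hq1 k
  rw [J, zpow_one, Jbar_three_sub hq0, Jm_eq_qPochInf 2]
  set P := qPochInf (q ^ 2) (q ^ 2)
  set E := Jm 8 q
  set N := theta (-q) (q ^ 2)
  set R := theta (-q ^ (5 + 2 * k)) ((q ^ 4) ^ 2)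
  set M := levelThreeSum (q ^ 4) (-q ^ (2 * k + 1)) k
  field_simp
  refine mul_left_cancel₀ hthetas ?_
  linear_combination E * N * hbailey + 2 * N * E * hdissect + 2 * (-1) ^ k * E * hdiag
    + 2 * N * q ^ (k ^ 2 + k) * M * hdouble + (-1) ^ k * R * E * hprod

theorem one_sub_neg_pow_mul_zpow_ne_zero (hq0 : q ≠ 0) (hq1 : ‖q‖ < 1) (k : ℕ) (l : ℤ) :
    1 - -q ^ (2 * k + 1) * ((q ^ 4) ^ 2) ^ l ≠ 0 := by
  have hexp : 1 - -q ^ (2 * k + 1) * ((q ^ 4) ^ 2) ^ l = 1 + q ^ (2 * k + 1 + 8 * l) := by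
    rw [neg_mul, sub_neg_eq_add]
    simp only [← zpow_natCast, ← zpow_mul, ← zpow_add₀ hq0]
    push_cast
    ring_nf
  rw [hexp]
  exact one_add_zpow_ne_zero hq1 (by lia)

theorem one_add_g_eq (hq0 : q ≠ 0) (hq1 : ‖q‖ < 1) :
    1 + -q * g (-q) (q ^ 8) = levelThreeSum (q ^ 4) (-q) 0 / Jm 8 q := by
  have hg := qPochInf_mul_one_add_g (pow_ne_zero 4 hq0) (norm_pow_lt_one hq1 four_ne_zero)
    (neg_ne_zero.2 hq0) (by simpa using one_sub_neg_pow_mul_zpow_ne_zero hq0 hq1 0)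
  rw [eq_div_iff (Jm_ne_zero (by norm_num) hq1), mul_comm, Jm_eight, ← hg, ← pow_mul q 4 2]

theorem g_eq (hq0 : q ≠ 0) (hq1 : ‖q‖ < 1) :
    g (-q ^ 3) (q ^ 8) = levelThreeSum (q ^ 4) (-q ^ 3) 1 / Jm 8 q := by
  have hg := qPochInf_mul_g (pow_ne_zero 4 hq0) (norm_pow_lt_one hq1 four_ne_zero)
    (neg_ne_zero.2 (pow_ne_zero 3 hq0)) (one_sub_neg_pow_mul_zpow_ne_zero hq0 hq1 1)
  rw [eq_div_iff (Jm_ne_zero (by norm_num) hq1), mul_comm, Jm_eight, ← hg, ← pow_mul q 4 2]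

end

end MockTheta

end

theorem theorem1p4 (q : ℂ) (hq0 : q ≠ 0) (hq1 : ‖q‖ < 1) :
    MockTheta.psiBar₀ q
        = 2 - 2 * q * MockTheta.g (-q) (q ^ 8)
          - MockTheta.J 1 2 q * MockTheta.Jbar 3 8 q / MockTheta.Jm 2 q ∧
      MockTheta.psiBar₁ q
        = 2 * q ^ 2 * MockTheta.g (-q ^ 3) (q ^ 8)
          + MockTheta.J 1 2 q * MockTheta.Jbar 1 8 q / MockTheta.Jm 2 q := by
  have hψ₀ := MockTheta.tsum_psiBar_eq hq0 hq1 zero_le_one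
  have hψ₁ := MockTheta.tsum_psiBar_eq hq0 hq1 le_rfl
  simp only [Nat.cast_zero, mul_zero, zero_mul, zero_add, add_zero, sub_zero, pow_zero, pow_one,
    zero_pow two_ne_zero, mul_one, one_mul, ← MockTheta.one_add_g_eq hq0 hq1] at hψ₀
  simp only [Nat.cast_one, mul_one, one_pow, pow_one, one_add_one_eq_two, two_add_one_eq_three,
    show (3 : ℤ) - 2 = 1 from rfl, ← MockTheta.g_eq hq0 hq1] at hψ₁
  rw [MockTheta.psiBar₀, MockTheta.psiBar₁]
  exact ⟨by linear_combination hψ₀, by linear_combination hψ₁⟩
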